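/- Let $m_1,m_2,m_3>0$ and $0<a<2$. Consider the planar three-body problem $$m_k\dot q_k=p_k,\qquad \dot p_k=g_k(q)=\sum_{j\ne k}\frac{m_jm_k}{|q_j-q_k|^{a+2}}(q_j-q_k),\qquad q_k(t)\in\mathbb{R}^2,\quad k=1,2,3,$$ with centre of mass at the origin, $\sum_k m_kq_k=0$. Put $$U(q)=\frac1a\sum_{j<k}\frac{m_jm_k}{|q_j-q_k|^a},\quad I(q)=\sum_k m_k|q_k|^2,\quad H=\frac12\sum_k\frac{|p_k|^2}{m_k}-U(q),\quad \mu(q)=U(q)\,I(q)^{a/2}.$$ A collision-free configuration $Q$ with $\sum_k m_kQ_k=0$ and $I(Q)=1$ is called central if $g_k(Q)+a\,\mu(Q)\,m_kQ_k=0$ for all $k$. For $k=1,2,3$ let $\mu_c^{(k)}$ be the value of $\mu$ at the rectilinear (collinear) central configuration in which body $k$ lies between the other two (it is unique up to rotation). The $k$-th critical path consists of the configurations on the level set $\mu=\mu_c^{(k)}$, in the space of collision-free configurations with centre of mass at the origin, that lie in the connected component of this level set passing through that rectilinear central configuration. Let $q$ be a solution, on its maximal interval $J$ of collision-free existence, with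 energy $H\ge 0$, along which the configurational measure $\mu(q(t))$ is constant, and assume that its configuration does not lie on any of the three critical paths. Then $q$ is homographic: there is $t_0\in J$ such that for every $t\in J$ there are a scalar $R(t)>0$ and an orthogonal $2\times2$ matrix $\Omega(t)$ with $q_k(t)=R(t)\,\Omega(t)\,q_k(t_0)$ for $k=1,2,3$. -/

import Mathlib

/-! The planar three-body problem with a homogeneous potential of degree `-a`.
The plane is `ℂ`, the bodies are indexed by `Fin 3`, and `m k` is the mass of body `k`. -/

noncomputable section

namespace ThreeBody

/-- The potential function `U = (1/a) ∑_{j<k} m_j m_k / r_{jk}^a`. -/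
def potential (m : Fin 3 → ℝ) (a : ℝ) (q : Fin 3 → ℂ) : ℝ :=
  (1 / a) * ∑ j, ∑ k ∈ Finset.Ioi j, m j * m k / ‖q j - q k‖ ^ a

/-- The force `g_k(q) = ∑_{j≠k} (m_j m_k / r_{jk}^{a+2}) (q_j - q_k)` on body `k`. -/
def force (m : Fin 3 → ℝ) (a : ℝ) (q : Fin 3 → ℂ) (k : Fin 3) : ℂ :=
  ∑ j ∈ Finset.univ.erase k, (m j * m k / ‖q j - q k‖ ^ (a + 2)) • (q j - q k)

/-- The moment of inertia `I = ∑ m_k |q_k|²`. -/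
def inertia (m : Fin 3 → ℝ) (q : Fin 3 → ℂ) : ℝ :=
  ∑ k, m k * ‖q k‖ ^ 2

/-- The total energy `H = T - U`, where `T = (1/2) ∑ |p_k|² / m_k`. -/
def energy (m : Fin 3 → ℝ) (a : ℝ) (q p : Fin 3 → ℂ) : ℝ :=
  (1 / 2) * ∑ k, ‖p k‖ ^ 2 / m k - potential m a q

/-- The configurational measure `μ = U I^{a/2}`. -/
def configMeasure (m : Fin 3 → ℝ) (a : ℝ) (q : Fin 3 → ℂ) : ℝ :=
  potential m a q * inertia m q ^ (a / 2)

/-- Collision-free configurations whose centre of mass is at the origin. -/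
def configSpace (m : Fin 3 → ℝ) : Set (Fin 3 → ℂ) :=
  {q | Function.Injective q ∧ ∑ k, m k • q k = 0}

/-- `(q, p)` is a collision-free solution of the equations of motion
`m_k dq_k/dt = p_k`, `dp_k/dt = g_k(q)` on the nonempty open interval `J`. -/
structure IsSolution (m : Fin 3 → ℝ) (a : ℝ) (J : Set ℝ) (q p : ℝ → Fin 3 → ℂ) : Prop where
  isOpen : IsOpen J
  ordConnected : J.OrdConnected
  nonempty : J.Nonempty
  collisionFree : ∀ t ∈ J, Function.Injective (q t)
  hasDerivAt_pos : ∀ t ∈ J, ∀ k, HasDerivAt (fun s => q s k) ((m k)⁻¹ • p t k) t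
  hasDerivAt_mom : ∀ t ∈ J, ∀ k, HasDerivAt (fun s => p s k) (force m a (q t) k) t

/-- A solution that cannot be continued, as a collision-free solution, to a larger interval. -/
def IsMaximalSolution (m : Fin 3 → ℝ) (a : ℝ) (J : Set ℝ) (q p : ℝ → Fin 3 → ℂ) : Prop :=
  IsSolution m a J q p ∧
    ∀ (J' : Set ℝ) (q' p' : ℝ → Fin 3 → ℂ), IsSolution m a J' q' p' → J ⊆ J' →
      (∀ t ∈ J, q' t = q t ∧ p' t = p t) → J' = J

/-- The motion is homographic: for some fixed `t₀`, at every time `t` there are a scalar `R > 0`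
and an orthogonal transformation `Ω` of the plane with `q_k(t) = R Ω q_k(t₀)` for all `k`. -/
def IsHomographic (J : Set ℝ) (q : ℝ → Fin 3 → ℂ) : Prop :=
  ∃ t₀ ∈ J, ∀ t ∈ J, ∃ R : ℝ, 0 < R ∧ ∃ Ω : ℂ ≃ₗᵢ[ℝ] ℂ, ∀ k, q t k = R • Ω (q t₀ k)

/-- Central configurations, normalised by `I = 1`: `G_k(Q) = g_k(Q) + a μ m_k Q_k = 0`
for all `k`. -/
def IsCentralConfig (m : Fin 3 → ℝ) (a : ℝ) (Q : Fin 3 → ℂ) : Prop :=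
  Q ∈ configSpace m ∧ inertia m Q = 1 ∧
    ∀ k, force m a Q k + (a * configMeasure m a Q * m k) • Q k = 0

/-- Rectilinear central configurations in which body `k` lies between the other two. -/
def IsRectilinearCentralConfig (m : Fin 3 → ℝ) (a : ℝ) (k : Fin 3) (Q : Fin 3 → ℂ) : Prop :=
  IsCentralConfig m a Q ∧ Sbtw ℝ (Q (k + 1)) (Q k) (Q (k + 2))

/-- The `k`-th critical path `μ = μ_c^{(k)}`: the level set of the configurational measure
through the rectilinear central configurations with body `k` in the middle. Of the level set we
keep only the connected part that does pass through such a central configuration. -/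
def criticalPath (m : Fin 3 → ℝ) (a : ℝ) (k : Fin 3) : Set (Fin 3 → ℂ) :=
  {q | ∃ Q, IsRectilinearCentralConfig m a k Q ∧
    q ∈ connectedComponentIn
      {z | z ∈ configSpace m ∧ configMeasure m a z = configMeasure m a Q} Q}

end ThreeBody

end

/-! ### Potential, force and inertia: formulas, scaling, derivatives. -/

namespace ThreeBody

variable {m : Fin 3 → ℝ} {a : ℝ} {q : Fin 3 → ℂ}

/-! Put r = √I and κ = `shapeSpeed` = 2T·I − (∑⟨q_k, p_k⟩)². By Cauchy–Schwarz κ ≥ 0, with equality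
only when the velocity is a pure dilation; a rotation counts as motion of the unit shape. Constancy
of μ makes κ a first integral (`shapeSpeed_eq`). If κ = 0, the unit shape is frozen and the motion
is homographic.

Let κ > 0. Energy conservation turns κ ≤ 2T·I into κ ≤ 2H·I + 2μ·I^(1 − a/2), and a < 2 then keeps I
away from 0. Hence U and the momenta are bounded, the mutual distances stay away from 0, and the
solution exists for all future time (`Ici_subset`). Since H ≥ 0, the Lagrange–Jacobi identity gives
I''/2 ≥ (2 − a)U, which is incompatible with bounded I (`not_bddAbove_inertia`).

The vector `defect` is the gradient of μ at the unit shape, so it is orthogonal to the shape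
velocity w. Differentiating this orthogonality gives r^(1−a)·|defect|² = −⟨w, defect'⟩ in suitable
mass norms (`sum_norm_sq_defect`). As |w|² = κr² and the unit shape moves with velocity w/r³, the
right side is O(1/r), so |defect|² = O(r^(a−2)). Along times with I → ∞ the unit shapes, which lie
in a compact set, accumulate at a central configuration Q with measure μ (`exists_isCentralConfig`).

If Q is equilateral, μ is the absolute minimum, attained only at equilateral triangles, so every
q(t) is one and all are similar. Otherwise Q is rectilinear; the cone over the orbit, with Q added,
is a connected part of the level set, which puts the orbit on a critical path. -/

lemma potential_eq (m : Fin 3 → ℝ) (a : ℝ) (q : Fin 3 → ℂ) :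
    potential m a q = (1 / a) * (m 0 * m 1 / ‖q 0 - q 1‖ ^ a + m 0 * m 2 / ‖q 0 - q 2‖ ^ a
      + m 1 * m 2 / ‖q 1 - q 2‖ ^ a) := by
  have h0 : Finset.Ioi (0 : Fin 3) = {1, 2} := by decide
  have h1 : Finset.Ioi (1 : Fin 3) = {2} := by decide
  have h2 : Finset.Ioi (2 : Fin 3) = ∅ := by decide
  simp [potential, Fin.sum_univ_three, h0, h1, h2]

lemma force_zero (m : Fin 3 → ℝ) (a : ℝ) (q : Fin 3 → ℂ) :
    force m a q 0 = (m 0 * m 1 / ‖q 0 - q 1‖ ^ (a + 2)) • (q 1 - q 0)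
      + (m 0 * m 2 / ‖q 0 - q 2‖ ^ (a + 2)) • (q 2 - q 0) := by
  have h0 : Finset.univ.erase (0 : Fin 3) = {1, 2} := by decide
  rw [force, h0, Finset.sum_pair (by decide), norm_sub_rev, norm_sub_rev (q 2), mul_comm (m 1),
    mul_comm (m 2)]

lemma force_one (m : Fin 3 → ℝ) (a : ℝ) (q : Fin 3 → ℂ) :
    force m a q 1 = (m 0 * m 1 / ‖q 0 - q 1‖ ^ (a + 2)) • (q 0 - q 1)
      + (m 1 * m 2 / ‖q 1 - q 2‖ ^ (a + 2)) • (q 2 - q 1) := by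
  have h0 : Finset.univ.erase (1 : Fin 3) = {0, 2} := by decide
  rw [force, h0, Finset.sum_pair (by decide), norm_sub_rev (q 2), mul_comm (m 2)]

lemma force_two (m : Fin 3 → ℝ) (a : ℝ) (q : Fin 3 → ℂ) :
    force m a q 2 = (m 0 * m 2 / ‖q 0 - q 2‖ ^ (a + 2)) • (q 0 - q 2)
      + (m 1 * m 2 / ‖q 1 - q 2‖ ^ (a + 2)) • (q 1 - q 2) := by
  have h0 : Finset.univ.erase (2 : Fin 3) = {0, 1} := by decide
  rw [force, h0, Finset.sum_pair (by decide)]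

lemma sum_inner_force (m : Fin 3 → ℝ) (a : ℝ) (q v : Fin 3 → ℂ) :
    ∑ k, inner ℝ (v k) (force m a q k) =
      -(m 0 * m 1 / ‖q 0 - q 1‖ ^ (a + 2) * inner ℝ (q 0 - q 1) (v 0 - v 1)
      + m 0 * m 2 / ‖q 0 - q 2‖ ^ (a + 2) * inner ℝ (q 0 - q 2) (v 0 - v 2)
      + m 1 * m 2 / ‖q 1 - q 2‖ ^ (a + 2) * inner ℝ (q 1 - q 2) (v 1 - v 2)) := by
  simp only [Fin.sum_univ_three, force_zero, force_one, force_two, inner_add_right,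
    inner_smul_right, inner_sub_left, inner_sub_right, real_inner_comm]
  ring

lemma norm_sub_pos_of_injective (hq : Function.Injective q) {j k : Fin 3} (hjk : j ≠ k) :
    0 < ‖q j - q k‖ :=
  norm_pos_iff.2 (sub_ne_zero.2 (hq.ne hjk))

/-- Euler's relation for a potential homogeneous of degree −a. -/
lemma sum_inner_self_force (ha : a ≠ 0) (hq : Function.Injective q) :
    ∑ k, inner ℝ (q k) (force m a q k) = -(a * potential m a q) := by
  have key : ∀ (c x : ℝ), 0 < x → c / x ^ (a + 2) * (x ^ 2) = c / x ^ a := by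
    intro c x hx
    rw [Real.rpow_add hx, Real.rpow_two]
    have := (Real.rpow_pos_of_pos hx a).ne'
    field_simp
  rw [sum_inner_force, potential_eq]
  simp only [real_inner_self_eq_norm_sq]
  rw [key _ _ (norm_sub_pos_of_injective hq (by decide)),
    key _ _ (norm_sub_pos_of_injective hq (by decide)),
    key _ _ (norm_sub_pos_of_injective hq (by decide))]
  field_simp

lemma force_smul (m : Fin 3 → ℝ) (a : ℝ) (q : Fin 3 → ℂ) {s : ℝ} (hs : 0 < s) (k : Fin 3) :
    force m a (s • q) k = (s ^ (a + 1))⁻¹ • force m a q k := by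
  rw [force, force, Finset.smul_sum]
  refine Finset.sum_congr rfl fun j _ => ?_
  have h1 : s ^ (a + 2) = s ^ (a + 1) * s := by
    rw [← Real.rpow_add_one hs.ne']; ring_nf
  have h2 := (Real.rpow_pos_of_pos hs (a + 1)).ne'
  simp only [Pi.smul_apply, ← smul_sub, norm_smul, Real.norm_of_nonneg hs.le, smul_smul]
  rw [Real.mul_rpow hs.le (norm_nonneg _), h1]
  congr 1
  field_simp

lemma potential_smul (m : Fin 3 → ℝ) (a : ℝ) (q : Fin 3 → ℂ) {s : ℝ} (hs : 0 < s) :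
    potential m a (s • q) = (s ^ a)⁻¹ * potential m a q := by
  simp only [potential_eq, Pi.smul_apply, ← smul_sub, norm_smul, Real.norm_of_nonneg hs.le,
    Real.mul_rpow hs.le (norm_nonneg _), div_eq_mul_inv, mul_inv]
  ring

lemma inertia_smul (m : Fin 3 → ℝ) (q : Fin 3 → ℂ) (s : ℝ) :
    inertia m (s • q) = s ^ 2 * inertia m q := by
  simp only [inertia, Pi.smul_apply, norm_smul, Finset.mul_sum, mul_pow, Real.norm_eq_abs, sq_abs]
  exact Finset.sum_congr rfl fun _ _ => by ring

lemma inertia_nonneg (hm : ∀ k, 0 < m k) (q : Fin 3 → ℂ) : 0 ≤ inertia m q :=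
  Finset.sum_nonneg fun k _ => mul_nonneg (hm k).le (sq_nonneg _)

lemma configMeasure_smul (hm : ∀ k, 0 < m k) (a : ℝ) (q : Fin 3 → ℂ) {s : ℝ} (hs : 0 < s) :
    configMeasure m a (s • q) = configMeasure m a q := by
  have h : (s ^ 2) ^ (a / 2) = s ^ a := by
    rw [← Real.rpow_two, ← Real.rpow_mul hs.le]; congr 1; ring
  have h2 := (Real.rpow_pos_of_pos hs a).ne'
  rw [configMeasure, configMeasure, potential_smul m a q hs, inertia_smul,
    Real.mul_rpow (by positivity) (inertia_nonneg hm q), h]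
  field_simp

lemma smul_mem_configSpace (hq : q ∈ configSpace m) {s : ℝ} (hs : 0 < s) :
    s • q ∈ configSpace m := by
  refine ⟨fun j k h => hq.1 ?_, ?_⟩
  · exact smul_right_injective ℂ hs.ne' h
  · simp only [Pi.smul_apply, smul_comm _ s, ← Finset.smul_sum, hq.2, smul_zero]

lemma inertia_pos (hm : ∀ k, 0 < m k) (hq : Function.Injective q) : 0 < inertia m q := by
  refine (inertia_nonneg hm q).lt_of_ne' fun h => ?_
  have h' := (Finset.sum_eq_zero_iff_of_nonneg
    (fun k _ => mul_nonneg (hm k).le (sq_nonneg ‖q k‖))).1 h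
  have h0 : ∀ k, q k = 0 := fun k => by simpa [(hm k).ne'] using h' k (Finset.mem_univ k)
  exact absurd (hq ((h0 0).trans (h0 1).symm)) (by decide)

lemma potential_pos (hm : ∀ k, 0 < m k) (ha : 0 < a) (hq : Function.Injective q) :
    0 < potential m a q := by
  have := norm_sub_pos_of_injective hq (show (0 : Fin 3) ≠ 1 by decide)
  have := norm_sub_pos_of_injective hq (show (0 : Fin 3) ≠ 2 by decide)
  have := norm_sub_pos_of_injective hq (show (1 : Fin 3) ≠ 2 by decide)
  have := hm 0
  have := hm 1
  have := hm 2
  rw [potential_eq]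
  positivity

/-- All terms of the potential are positive, so a bound on the sum bounds each inverse power of a
distance. -/
lemma potential_le_imp_le_norm_sub (hm : ∀ k, 0 < m k) (ha : 0 < a) (C : ℝ) :
    ∃ δ > 0, ∀ q : Fin 3 → ℂ, Function.Injective q → potential m a q ≤ C →
      ∀ j k, j ≠ k → δ ≤ ‖q j - q k‖ := by
  obtain ⟨b, hb, hbm⟩ : ∃ b > 0, ∀ j k : Fin 3, b ≤ m j * m k := by
    obtain ⟨i, hi⟩ := Finite.exists_min m
    exact ⟨m i * m i, mul_pos (hm i) (hm i),
      fun j k => mul_le_mul (hi j) (hi k) (hm i).le (hm j).le⟩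
  -- The maximum with 1 keeps the bound positive when C is not.
  set C' := a * max C 1 with hC'
  have hC'0 : 0 < C' := mul_pos ha (lt_max_of_lt_right one_pos)
  refine ⟨(b / C') ^ (a⁻¹), Real.rpow_pos_of_pos (div_pos hb hC'0) _, fun q hq hqC => ?_⟩
  have hp : ∀ j k : Fin 3, j ≠ k → 0 ≤ m j * m k / ‖q j - q k‖ ^ a := fun j k hjk =>
    div_nonneg (mul_pos (hm j) (hm k)).le
      (Real.rpow_pos_of_pos (norm_sub_pos_of_injective hq hjk) a).le
  have hsum : m 0 * m 1 / ‖q 0 - q 1‖ ^ a + m 0 * m 2 / ‖q 0 - q 2‖ ^ a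
      + m 1 * m 2 / ‖q 1 - q 2‖ ^ a ≤ C' := by
    have h := mul_le_mul_of_nonneg_left (hqC.trans (le_max_left C 1)) ha.le
    rw [potential_eq, ← mul_assoc, mul_one_div_cancel ha.ne', one_mul] at h
    exact h
  have h01 := hp 0 1 (by decide)
  have h02 := hp 0 2 (by decide)
  have h12 := hp 1 2 (by decide)
  have key : ∀ j k : Fin 3, j ≠ k → m j * m k / ‖q j - q k‖ ^ a ≤ C' →
      (b / C') ^ (a⁻¹) ≤ ‖q j - q k‖ := by
    intro j k hjk h
    have hr := norm_sub_pos_of_injective hq hjk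
    have hra := Real.rpow_pos_of_pos hr a
    rw [div_le_iff₀ hra] at h
    rw [Real.rpow_inv_le_iff_of_pos (div_pos hb hC'0).le hr.le ha, div_le_iff₀ hC'0, mul_comm]
    exact (hbm j k).trans h
  intro j k hjk
  fin_cases j <;> fin_cases k
  · exact absurd rfl hjk
  · exact key 0 1 (by decide) (by linarith)
  · exact key 0 2 (by decide) (by linarith)
  · rw [norm_sub_rev]; exact key 0 1 (by decide) (by linarith)
  · exact absurd rfl hjk
  · exact key 1 2 (by decide) (by linarith)
  · rw [norm_sub_rev]; exact key 0 2 (by decide) (by linarith)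
  · rw [norm_sub_rev]; exact key 1 2 (by decide) (by linarith)
  · exact absurd rfl hjk

lemma contDiffAt_force (m : Fin 3 → ℝ) (a : ℝ) (hq : Function.Injective q) (n : WithTop ℕ∞)
    (k : Fin 3) : ContDiffAt ℝ n (fun z => force m a z k) q := by
  unfold force
  refine ContDiffAt.sum fun j hj => ?_
  have hne : q j - q k ≠ 0 := sub_ne_zero.2 (hq.ne (Finset.ne_of_mem_erase hj))
  have hd : ContDiffAt ℝ n (fun z : Fin 3 → ℂ => z j - z k) q :=
    (contDiff_apply ℝ ℂ j).contDiffAt.sub (contDiff_apply ℝ ℂ k).contDiffAt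
  refine ContDiffAt.smul (contDiffAt_const.div ?_ ?_) hd
  · exact (hd.norm ℝ hne).rpow_const_of_ne (norm_ne_zero_iff.2 hne)
  · exact (Real.rpow_pos_of_pos (norm_pos_iff.2 hne) _).ne'

lemma hasDerivAt_div_norm_rpow {d : ℝ → ℂ} {d' : ℂ} {t : ℝ} (hd : HasDerivAt d d' t)
    (h0 : d t ≠ 0) (c a : ℝ) :
    HasDerivAt (fun s => c / ‖d s‖ ^ a) (-(a * (c / ‖d t‖ ^ (a + 2) * inner ℝ (d t) d'))) t := by
  have hpos : 0 < ‖d t‖ := norm_pos_iff.2 h0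
  have h1 := (hd.norm_sq.rpow_const (p := -(a / 2)) (Or.inl (by positivity))).const_mul c
  have hsq : ∀ z : ℂ, ∀ b : ℝ, (‖z‖ ^ 2) ^ b = ‖z‖ ^ (2 * b) := fun z b => by
    rw [← Real.rpow_two, ← Real.rpow_mul (norm_nonneg z)]
  simp only [hsq] at h1
  have hf : (fun s => c / ‖d s‖ ^ a) = fun s => c * ‖d s‖ ^ (2 * -(a / 2)) := by
    funext s
    rw [show 2 * -(a / 2) = -a by ring, Real.rpow_neg (norm_nonneg _), div_eq_mul_inv]
  rw [hf]
  refine h1.congr_deriv ?_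
  rw [show 2 * (-(a / 2) - 1) = -(a + 2) by ring, Real.rpow_neg (norm_nonneg _)]
  ring

/-- The force is the gradient of the potential. -/
lemma hasDerivAt_potential {x : ℝ → Fin 3 → ℂ} {v : Fin 3 → ℂ} {t : ℝ} (ha : a ≠ 0)
    (hx : ∀ k, HasDerivAt (fun s => x s k) (v k) t) (hinj : Function.Injective (x t)) :
    HasDerivAt (fun s => potential m a (x s)) (∑ k, inner ℝ (v k) (force m a (x t) k)) t := by
  simp only [potential_eq, sum_inner_force]
  have key : ∀ j k : Fin 3, j ≠ k → ∀ c : ℝ, HasDerivAt (fun s => c / ‖x s j - x s k‖ ^ a)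
      (-(a * (c / ‖x t j - x t k‖ ^ (a + 2) * inner ℝ (x t j - x t k) (v j - v k)))) t :=
    fun j k hjk c => hasDerivAt_div_norm_rpow ((hx j).sub (hx k)) (sub_ne_zero.2 (hinj.ne hjk)) c a
  refine ((((key 0 1 (by decide) (m 0 * m 1)).add (key 0 2 (by decide) (m 0 * m 2))).add
    (key 1 2 (by decide) (m 1 * m 2))).const_mul (1 / a)).congr_deriv ?_
  field_simp
  ring

lemma isOpen_injective : IsOpen {z : Fin 3 → ℂ | Function.Injective z} := by
  have : {z : Fin 3 → ℂ | Function.Injective z} = ⋂ j, ⋂ k, ⋂ _ : j ≠ k, {z | z j ≠ z k} := by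
    ext z
    simp only [Set.mem_ofPred_eq, Set.mem_iInter]
    exact ⟨fun h j k hjk => h.ne hjk, fun h j k hjk => by_contra fun hne => h j k hne hjk⟩
  rw [this]
  refine isOpen_iInter_of_finite fun j => isOpen_iInter_of_finite fun k =>
    isOpen_iInter_of_finite fun _ => ?_
  exact isOpen_ne_fun (continuous_apply j) (continuous_apply k)

lemma continuousAt_potential (m : Fin 3 → ℝ) (a : ℝ) (hq : Function.Injective q) :
    ContinuousAt (fun z => potential m a z) q := by
  simp only [potential_eq]
  have key : ∀ j k : Fin 3, j ≠ k → ∀ c : ℝ,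
      ContinuousAt (fun z : Fin 3 → ℂ => c / ‖z j - z k‖ ^ a) q := by
    intro j k hjk c
    have hp := norm_sub_pos_of_injective hq hjk
    refine continuousAt_const.div (ContinuousAt.rpow_const ?_ (Or.inl hp.ne'))
      (Real.rpow_pos_of_pos hp a).ne'
    exact Continuous.continuousAt (by fun_prop)
  exact continuousAt_const.mul (((key 0 1 (by decide) _).add (key 0 2 (by decide) _)).add
    (key 1 2 (by decide) _))

lemma continuous_inertia (m : Fin 3 → ℝ) : Continuous (inertia m) := by
  unfold inertia; fun_prop

end ThreeBody

/-! ### Equilateral and rectilinear configurations. -/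

namespace ThreeBody

variable {m : Fin 3 → ℝ} {a : ℝ} {q : Fin 3 → ℂ}

/-- Lagrange's identity. -/
lemma sum_mass_mul_inertia (hq : ∑ k, m k • q k = 0) :
    (m 0 + m 1 + m 2) * inertia m q = m 0 * m 1 * ‖q 0 - q 1‖ ^ 2 + m 0 * m 2 * ‖q 0 - q 2‖ ^ 2
      + m 1 * m 2 * ‖q 1 - q 2‖ ^ 2 := by
  have hre := congrArg Complex.re hq
  have him := congrArg Complex.im hq
  simp only [Fin.sum_univ_three, Complex.add_re, Complex.add_im, Complex.real_smul,
    Complex.re_ofReal_mul, Complex.im_ofReal_mul, Complex.zero_re, Complex.zero_im] at hre him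
  simp only [inertia, Fin.sum_univ_three, Complex.sq_norm, Complex.normSq_apply, Complex.sub_re,
    Complex.sub_im]
  linear_combination (m 0 * (q 0).re + m 1 * (q 1).re + m 2 * (q 2).re) * hre
    + (m 0 * (q 0).im + m 1 * (q 1).im + m 2 * (q 2).im) * him

/-- The three mutual distances agree. -/
def IsEquilateral (q : Fin 3 → ℂ) : Prop :=
  ‖q 0 - q 1‖ = ‖q 0 - q 2‖ ∧ ‖q 0 - q 1‖ = ‖q 1 - q 2‖

/-- The strictly convex function x ↦ x^(−b) lies above its tangent at 1; this strictness is what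
makes the minimum of the measure unique. -/
lemma one_sub_mul_lt_rpow_neg {b x : ℝ} (hb : 0 < b) (hx : 0 < x) (hx1 : x ≠ 1) :
    1 - b * (x - 1) < x ^ (-b) := by
  have h1 := Real.add_one_le_exp (Real.log x * -b)
  have h2 := mul_lt_mul_of_pos_left (Real.log_lt_sub_one_of_pos hx hx1) hb
  rw [Real.rpow_def_of_pos hx]
  linarith

lemma one_sub_mul_le_rpow_neg {b x : ℝ} (hb : 0 < b) (hx : 0 < x) :
    1 - b * (x - 1) ≤ x ^ (-b) := by
  rcases eq_or_ne x 1 with rfl | h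
  · simp
  · exact (one_sub_mul_lt_rpow_neg hb hx h).le

/-- The configurational measure in terms of the squared distances, normalised so that their
weighted mean is one. -/
lemma configMeasure_eq_sum_rpow (hm : ∀ k, 0 < m k) (ha : 0 < a) (hq : q ∈ configSpace m) {W L : ℝ}
    (hW : W = m 0 * m 1 + m 0 * m 2 + m 1 * m 2)
    (hL : L = (m 0 + m 1 + m 2) * inertia m q / W) :
    a * configMeasure m a q = ((m 0 + m 1 + m 2) / W) ^ (-(a / 2)) *
      (m 0 * m 1 * (‖q 0 - q 1‖ ^ 2 / L) ^ (-(a / 2)) + m 0 * m 2 * (‖q 0 - q 2‖ ^ 2 / L) ^ (-(a / 2))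
        + m 1 * m 2 * (‖q 1 - q 2‖ ^ 2 / L) ^ (-(a / 2))) := by
  have h0 := hm 0
  have h1 := hm 1
  have h2 := hm 2
  have hI := inertia_pos hm hq.1
  have hW0 : 0 < W := by rw [hW]; positivity
  have hM : 0 < (m 0 + m 1 + m 2) / W := by positivity
  have hL' : L = (m 0 + m 1 + m 2) / W * inertia m q := by rw [hL]; ring
  have hL0 : 0 < L := by rw [hL']; positivity
  have key : ∀ c r : ℝ, 0 < r → ((m 0 + m 1 + m 2) / W) ^ (-(a / 2)) *
      (c * (r ^ 2 / L) ^ (-(a / 2))) = c / r ^ a * inertia m q ^ (a / 2) := by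
    intro c r hr
    have hr2 : (r ^ 2) ^ (a / 2) = r ^ a := by
      rw [← Real.rpow_two, ← Real.rpow_mul hr.le]; congr 1; ring
    rw [Real.rpow_neg (by positivity), Real.rpow_neg (by positivity),
      Real.div_rpow (sq_nonneg r) hL0.le, hr2, hL', Real.mul_rpow hM.le hI.le]
    have := (Real.rpow_pos_of_pos hM (a / 2)).ne'
    field_simp
  rw [mul_add, mul_add, key _ _ (norm_sub_pos_of_injective hq.1 (by decide)),
    key _ _ (norm_sub_pos_of_injective hq.1 (by decide)),
    key _ _ (norm_sub_pos_of_injective hq.1 (by decide)), configMeasure, potential_eq]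
  field_simp

/-- Equilateral configurations are the only minima of the configurational measure. -/
lemma IsEquilateral.of_configMeasure_eq (hm : ∀ k, 0 < m k) (ha : 0 < a) {Q : Fin 3 → ℂ}
    (hQ : Q ∈ configSpace m) (hQe : IsEquilateral Q) (hq : q ∈ configSpace m)
    (hμ : configMeasure m a q = configMeasure m a Q) : IsEquilateral q := by
  have h0 := hm 0
  have h1 := hm 1
  have h2 := hm 2
  obtain ⟨W, hW⟩ : ∃ W, W = m 0 * m 1 + m 0 * m 2 + m 1 * m 2 := ⟨_, rfl⟩
  have hW0 : 0 < W := by rw [hW]; positivity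
  have hc : 0 < ((m 0 + m 1 + m 2) / W) ^ (-(a / 2)) := Real.rpow_pos_of_pos (by positivity) _
  have hQ1 := configMeasure_eq_sum_rpow hm ha hQ hW rfl
  have hq1 := configMeasure_eq_sum_rpow hm ha hq hW rfl
  have hLQ : (m 0 + m 1 + m 2) * inertia m Q / W = ‖Q 0 - Q 1‖ ^ 2 := by
    rw [sum_mass_mul_inertia hQ.2, ← hQe.1, ← hQe.2, hW]
    field_simp
  have hrQ := norm_sub_pos_of_injective hQ.1 (show (0 : Fin 3) ≠ 1 by decide)
  rw [hLQ, ← hQe.1, ← hQe.2, div_self (by positivity), Real.one_rpow] at hQ1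
  have hIq := inertia_pos hm hq.1
  obtain ⟨L, hL⟩ : ∃ L, L = (m 0 + m 1 + m 2) * inertia m q / W := ⟨_, rfl⟩
  have hL0 : 0 < L := by rw [hL]; positivity
  have hsum : m 0 * m 1 * (‖q 0 - q 1‖ ^ 2 / L) + m 0 * m 2 * (‖q 0 - q 2‖ ^ 2 / L)
      + m 1 * m 2 * (‖q 1 - q 2‖ ^ 2 / L) = W := by
    have hLW : L * W = (m 0 + m 1 + m 2) * inertia m q := by rw [hL]; field_simp
    rw [sum_mass_mul_inertia hq.2] at hLW
    field_simp
    linarith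
  rw [← hL, hμ, hQ1] at hq1
  have hq2 := mul_left_cancel₀ hc.ne' hq1
  have hr01 := norm_sub_pos_of_injective hq.1 (show (0 : Fin 3) ≠ 1 by decide)
  have hr02 := norm_sub_pos_of_injective hq.1 (show (0 : Fin 3) ≠ 2 by decide)
  have hr12 := norm_sub_pos_of_injective hq.1 (show (1 : Fin 3) ≠ 2 by decide)
  have hx : 0 < ‖q 0 - q 1‖ ^ 2 / L := by positivity
  have hy : 0 < ‖q 0 - q 2‖ ^ 2 / L := by positivity
  have hz : 0 < ‖q 1 - q 2‖ ^ 2 / L := by positivity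
  have hb : 0 < a / 2 := by positivity
  have w01 : 0 < m 0 * m 1 := by positivity
  have w02 : 0 < m 0 * m 2 := by positivity
  have w12 : 0 < m 1 * m 2 := by positivity
  have lx := mul_le_mul_of_nonneg_left (one_sub_mul_le_rpow_neg hb hx) w01.le
  have ly := mul_le_mul_of_nonneg_left (one_sub_mul_le_rpow_neg hb hy) w02.le
  have lz := mul_le_mul_of_nonneg_left (one_sub_mul_le_rpow_neg hb hz) w12.le
  have hsum' := congrArg (a / 2 * ·) hsum
  simp only [hW] at hsum'
  -- By `hsum` the weighted mean of the three ratios is 1, so the linear terms cancel and the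
  -- tangent bounds add up to an equality. None of them can then be strict.
  have ex : ‖q 0 - q 1‖ ^ 2 / L = 1 := by
    by_contra h
    have := mul_lt_mul_of_pos_left (one_sub_mul_lt_rpow_neg hb hx h) w01
    linarith
  have ey : ‖q 0 - q 2‖ ^ 2 / L = 1 := by
    by_contra h
    have := mul_lt_mul_of_pos_left (one_sub_mul_lt_rpow_neg hb hy h) w02
    linarith
  have ez : ‖q 1 - q 2‖ ^ 2 / L = 1 := by
    by_contra h
    have := mul_lt_mul_of_pos_left (one_sub_mul_lt_rpow_neg hb hz h) w12
    linarith
  rw [div_eq_one_iff_eq hL0.ne'] at ex ey ez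
  exact ⟨(sq_eq_sq₀ hr01.le hr02.le).1 (ex.trans ey.symm),
    (sq_eq_sq₀ hr01.le hr12.le).1 (ex.trans ez.symm)⟩

/-- A configuration with centre of mass at the origin is determined by two of its sides. -/
lemma eq_mul_of_sides (hm : ∀ k, 0 < m k) {z : Fin 3 → ℂ} (hz : ∑ k, m k • z k = 0)
    (hq : ∑ k, m k • q k = 0) {c : ℂ} (h1 : z 1 - z 0 = c * (q 1 - q 0))
    (h2 : z 2 - z 0 = c * (q 2 - q 0)) (k : Fin 3) : z k = c * q k := by
  have hM : ((m 0 + m 1 + m 2 : ℝ) : ℂ) ≠ 0 := by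
    have h0 := hm 0
    have h1 := hm 1
    have h2 := hm 2
    exact_mod_cast (show (0 : ℝ) < m 0 + m 1 + m 2 by positivity).ne'
  simp only [Fin.sum_univ_three, Complex.real_smul] at hz hq
  push_cast at hM
  have e0 : z 0 = c * q 0 := by
    apply mul_left_cancel₀ hM
    linear_combination hz - c * hq - m 1 * h1 - m 2 * h2
  fin_cases k
  · exact e0
  · show z 1 = c * q 1
    linear_combination e0 + h1
  · show z 2 = c * q 2
    linear_combination e0 + h2

lemma exists_smul_rotation {c : ℂ} (hc : c ≠ 0) :
    ∃ Ω : ℂ ≃ₗᵢ[ℝ] ℂ, ∀ z, c * z = ‖c‖ • Ω z := by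
  have hn : ‖c‖ ≠ 0 := norm_ne_zero_iff.2 hc
  refine ⟨rotation ⟨c / ‖c‖, ?_⟩, fun z => ?_⟩
  · simp [Submonoid.unitSphere, hn]
  · have : (‖c‖ : ℂ) ≠ 0 := by exact_mod_cast hn
    show c * z = ‖c‖ • (c / ‖c‖ * z)
    rw [Complex.real_smul]
    field_simp

/-- The ratio u of two sides satisfies |u| = |u − 1| = 1, so u = exp(±iπ/3); the sign is the
orientation. -/
lemma IsEquilateral.side_div (hq : Function.Injective q) (he : IsEquilateral q) :
    ((q 2 - q 0) / (q 1 - q 0)).re = 1 / 2 ∧ ((q 2 - q 0) / (q 1 - q 0)).im ^ 2 = 3 / 4 := by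
  have h0 : q 1 - q 0 ≠ 0 := sub_ne_zero.2 (hq.ne (by decide))
  have hn : ‖q 1 - q 0‖ ≠ 0 := norm_ne_zero_iff.2 h0
  have e1 : ‖(q 2 - q 0) / (q 1 - q 0)‖ = 1 := by
    rw [norm_div, norm_sub_rev (q 2), ← he.1, norm_sub_rev (q 0), div_self hn]
  have e2 : ‖(q 2 - q 0) / (q 1 - q 0) - 1‖ = 1 := by
    have : (q 2 - q 0) / (q 1 - q 0) - 1 = (q 2 - q 1) / (q 1 - q 0) := by field_simp; ring
    rw [this, norm_div, norm_sub_rev (q 2), ← he.2, norm_sub_rev (q 0), div_self hn]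
  generalize (q 2 - q 0) / (q 1 - q 0) = u at e1 e2
  have e1' := congrArg (· ^ 2) e1
  have e2' := congrArg (· ^ 2) e2
  simp only [Complex.sq_norm, Complex.normSq_apply, Complex.sub_re, Complex.sub_im,
    Complex.one_re, Complex.one_im] at e1' e2'
  have : u.re = 1 / 2 := by linarith
  rw [this] at e1'
  exact ⟨this, by linarith⟩

/-- Triangles of equal orientation differ by a complex factor. Opposite orientations are reconciled
by first conjugating one triangle, whence a reflection in Ω. -/
lemma IsEquilateral.similar (hm : ∀ k, 0 < m k) {z : Fin 3 → ℂ} (hz : z ∈ configSpace m)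
    (hze : IsEquilateral z) (hq : q ∈ configSpace m) (hqe : IsEquilateral q) :
    ∃ R : ℝ, 0 < R ∧ ∃ Ω : ℂ ≃ₗᵢ[ℝ] ℂ, ∀ k, z k = R • Ω (q k) := by
  obtain ⟨zr, zi⟩ := hze.side_div hz.1
  obtain ⟨qr, qi⟩ := hqe.side_div hq.1
  have hz0 : z 1 - z 0 ≠ 0 := sub_ne_zero.2 (hz.1.ne (by decide))
  have hq0 : q 1 - q 0 ≠ 0 := sub_ne_zero.2 (hq.1.ne (by decide))
  rcases sq_eq_sq_iff_eq_or_eq_neg.1 (zi.trans qi.symm) with him | him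
  · have hu : (z 2 - z 0) / (z 1 - z 0) = (q 2 - q 0) / (q 1 - q 0) :=
      Complex.ext (zr.trans qr.symm) him
    have hc : (z 1 - z 0) / (q 1 - q 0) ≠ 0 := div_ne_zero hz0 hq0
    obtain ⟨Ω, hΩ⟩ := exists_smul_rotation hc
    refine ⟨_, norm_pos_iff.2 hc, Ω, fun k => ?_⟩
    rw [← hΩ]
    refine eq_mul_of_sides hm hz.2 hq.2 (by field_simp) ?_ k
    field_simp at hu ⊢
    linear_combination hu
  · set q' : Fin 3 → ℂ := fun k => (starRingEnd ℂ) (q k) with hq'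
    have hq'c : ∑ k, m k • q' k = 0 := by
      have := congrArg (starRingEnd ℂ) hq.2
      simpa [hq', Fin.sum_univ_three] using this
    have hq'0 : q' 1 - q' 0 ≠ 0 := by
      simpa only [hq', ← map_sub, map_ne_zero] using hq0
    have hu : (z 2 - z 0) / (z 1 - z 0) = (q' 2 - q' 0) / (q' 1 - q' 0) := by
      simp only [hq', ← map_sub, ← map_div₀]
      exact Complex.ext (zr.trans qr.symm) him
    have hc : (z 1 - z 0) / (q' 1 - q' 0) ≠ 0 := div_ne_zero hz0 hq'0
    obtain ⟨Ω, hΩ⟩ := exists_smul_rotation hc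
    refine ⟨_, norm_pos_iff.2 hc, Complex.conjLIE.trans Ω, fun k => ?_⟩
    have h : z k = (z 1 - z 0) / (q' 1 - q' 0) * q' k := by
      refine eq_mul_of_sides hm hz.2 hq'c (by field_simp) ?_ k
      field_simp at hu ⊢
      linear_combination hu
    rw [h, hΩ]
    rfl

lemma collinear_of_smul_add_smul {x y z : ℂ} {α β : ℝ} (h : α • (y - x) + β • (z - x) = 0)
    (h0 : α ≠ 0 ∨ β ≠ 0) : Collinear ℝ {x, y, z} := by
  rw [collinear_iff_of_mem (p₀ := x) (by simp)]
  rcases h0 with h0 | h0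
  · refine ⟨z - x, ?_⟩
    have hy : y = (-(β / α)) • (z - x) + x := by
      have h' := congrArg (α⁻¹ • ·) h
      simp only [smul_add, smul_smul, inv_mul_cancel₀ h0, one_smul, smul_zero] at h'
      rw [neg_smul, div_eq_inv_mul]
      linear_combination h'
    simp only [Set.mem_insert_iff, Set.mem_singleton_iff, vadd_eq_add]
    rintro p (rfl | rfl | rfl)
    · exact ⟨0, by simp⟩
    · exact ⟨_, hy⟩
    · exact ⟨1, by simp⟩
  · refine ⟨y - x, ?_⟩
    have hy : z = (-(α / β)) • (y - x) + x := by
      have h' := congrArg (β⁻¹ • ·) h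
      simp only [smul_add, smul_smul, inv_mul_cancel₀ h0, one_smul, smul_zero] at h'
      rw [neg_smul, div_eq_inv_mul]
      linear_combination h'
    simp only [Set.mem_insert_iff, Set.mem_singleton_iff, vadd_eq_add]
    rintro p (rfl | rfl | rfl)
    · exact ⟨0, by simp⟩
    · exact ⟨1, by simp⟩
    · exact ⟨_, hy⟩

lemma IsCentralConfig.isRectilinear_of_collinear {Q : Fin 3 → ℂ} (hQ : IsCentralConfig m a Q)
    (h : Collinear ℝ {Q 0, Q 1, Q 2}) : ∃ k, IsRectilinearCentralConfig m a k Q := by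
  have hinj := hQ.1.1
  -- The outer bodies are listed cyclically as k + 1, k + 2, hence the reversals.
  rcases h.wbtw_or_wbtw_or_wbtw with h | h | h
  · exact ⟨1, hQ, (show Sbtw ℝ (Q 0) (Q 1) (Q 2) from
      ⟨h, hinj.ne (by decide), hinj.ne (by decide)⟩).symm⟩
  · exact ⟨2, hQ, (show Sbtw ℝ (Q 1) (Q 2) (Q 0) from
      ⟨h, hinj.ne (by decide), hinj.ne (by decide)⟩).symm⟩
  · exact ⟨0, hQ, (show Sbtw ℝ (Q 2) (Q 0) (Q 1) from
      ⟨h, hinj.ne (by decide), hinj.ne (by decide)⟩).symm⟩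

/-- Central configurations of three bodies are equilateral or rectilinear. -/
lemma IsCentralConfig.isEquilateral_or (hm : ∀ k, 0 < m k) (ha : 0 < a) {Q : Fin 3 → ℂ}
    (hQ : IsCentralConfig m a Q) :
    IsEquilateral Q ∨ ∃ k, IsRectilinearCentralConfig m a k Q := by
  by_cases hcol : Collinear ℝ {Q 0, Q 1, Q 2}
  · exact Or.inr (hQ.isRectilinear_of_collinear hcol)
  left
  have h0 := hm 0
  have h1 := hm 1
  have h2 := hm 2
  -- The value that every r^(−(a+2)) will turn out to have.
  obtain ⟨lam, hlam⟩ : ∃ lam, lam = a * configMeasure m a Q / (m 0 + m 1 + m 2) := ⟨_, rfl⟩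
  have hM : m 0 + m 1 + m 2 ≠ 0 := by positivity
  have hlamM : a * configMeasure m a Q = lam * (m 0 + m 1 + m 2) := by
    rw [hlam]; field_simp
  have hcm := hQ.1.2
  have e0 := hQ.2.2 0
  have e1 := hQ.2.2 1
  rw [force_zero, hlamM] at e0
  rw [force_one, hlamM] at e1
  simp only [Fin.sum_univ_three] at hcm
  -- Subtracting a multiple of the centre-of-mass relation leaves only the two sides at body 0.
  have f0 : (m 0 * m 1 / ‖Q 0 - Q 1‖ ^ (a + 2) - lam * (m 0 * m 1)) • (Q 1 - Q 0)
      + (m 0 * m 2 / ‖Q 0 - Q 2‖ ^ (a + 2) - lam * (m 0 * m 2)) • (Q 2 - Q 0) = 0 := by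
    simp only [Complex.real_smul] at e0 hcm ⊢
    push_cast at e0 ⊢
    linear_combination e0 - lam * m 0 * hcm
  have f1 : (m 0 * m 1 / ‖Q 0 - Q 1‖ ^ (a + 2) - lam * (m 0 * m 1)) • (Q 0 - Q 1)
      + (m 1 * m 2 / ‖Q 1 - Q 2‖ ^ (a + 2) - lam * (m 1 * m 2)) • (Q 2 - Q 1) = 0 := by
    simp only [Complex.real_smul] at e1 hcm ⊢
    push_cast at e1 ⊢
    linear_combination e1 - lam * m 1 * hcm
  -- Sides of a nondegenerate triangle are independent, so both coefficients vanish.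
  have g0 := not_or.1 (mt (collinear_of_smul_add_smul f0) hcol)
  have g1 := not_or.1 (mt (collinear_of_smul_add_smul f1)
    (by rwa [Set.insert_comm]))
  have key : ∀ c r : ℝ, 0 < c → 0 < r → ¬ (c / r ^ (a + 2) - lam * c ≠ 0) →
      r ^ (a + 2) = lam⁻¹ := by
    intro c r hc hr h
    have hr' := Real.rpow_pos_of_pos hr (a + 2)
    rw [not_not, sub_eq_zero] at h
    have : lam * r ^ (a + 2) = 1 := by
      field_simp at h
      linarith
    exact eq_inv_of_mul_eq_one_right this
  have r01 := norm_sub_pos_of_injective hQ.1.1 (show (0 : Fin 3) ≠ 1 by decide)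
  have r02 := norm_sub_pos_of_injective hQ.1.1 (show (0 : Fin 3) ≠ 2 by decide)
  have r12 := norm_sub_pos_of_injective hQ.1.1 (show (1 : Fin 3) ≠ 2 by decide)
  have k01 := key _ _ (by positivity) r01 g0.1
  have k02 := key _ _ (by positivity) r02 g0.2
  have k12 := key _ _ (by positivity) r12 g1.2
  have ha2 : a + 2 ≠ 0 := by positivity
  exact ⟨(Real.rpow_left_inj r01.le r02.le ha2).1 (k01.trans k02.symm),
    (Real.rpow_left_inj r01.le r12.le ha2).1 (k01.trans k12.symm)⟩

end ThreeBody

/-! ### Shape velocity and its conserved size. -/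

namespace ThreeBody

variable {m : Fin 3 → ℝ} {a : ℝ} {J : Set ℝ} {q p : ℝ → Fin 3 → ℂ} {t : ℝ}

/-- The virial `∑ ⟨q_k, p_k⟩`, half the derivative of the moment of inertia. -/
noncomputable def virial (q p : Fin 3 → ℂ) : ℝ := ∑ k, inner ℝ (q k) (p k)

/-- Twice the kinetic energy. -/
noncomputable def vis (m : Fin 3 → ℝ) (p : Fin 3 → ℂ) : ℝ := ∑ k, ‖p k‖ ^ 2 / m k

/-- The configuration scaled to unit moment of inertia. -/
noncomputable def unitShape (m : Fin 3 → ℝ) (q : Fin 3 → ℂ) : Fin 3 → ℂ := (√(inertia m q))⁻¹ • q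

/-- The velocity with its dilation part removed, multiplied by the moment of inertia. -/
noncomputable def shapeVelocity (m : Fin 3 → ℝ) (q p : Fin 3 → ℂ) : Fin 3 → ℂ :=
  fun k => (inertia m q * (m k)⁻¹) • p k - virial q p • q k

/-- The square of the rate of change of shape, in the time `∫ dt / I`. -/
noncomputable def shapeSpeed (m : Fin 3 → ℝ) (q p : Fin 3 → ℂ) : ℝ :=
  vis m p * inertia m q - virial q p ^ 2

lemma energy_eq (m : Fin 3 → ℝ) (a : ℝ) (q p : Fin 3 → ℂ) :
    energy m a q p = vis m p / 2 - potential m a q := by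
  rw [energy, vis]; ring

/-- Makes κ a squared mass norm, hence nonnegative, and bounds the shape velocity by √(Iκ). -/
lemma sum_mass_inner_shapeVelocity_self (hm : ∀ k, 0 < m k) (q p : Fin 3 → ℂ) :
    ∑ k, m k * ‖shapeVelocity m q p k‖ ^ 2 = inertia m q * shapeSpeed m q p := by
  have h : ∀ k, m k * ‖shapeVelocity m q p k‖ ^ 2 = inertia m q ^ 2 * (‖p k‖ ^ 2 / m k)
      - 2 * inertia m q * virial q p * inner ℝ (q k) (p k)
      + virial q p ^ 2 * (m k * ‖q k‖ ^ 2) := by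
    intro k
    have := (hm k).ne'
    simp only [shapeVelocity]
    rw [norm_sub_sq_real, norm_smul, norm_smul, mul_pow, mul_pow, inner_smul_left,
      inner_smul_right, real_inner_comm (q k), Real.norm_eq_abs, Real.norm_eq_abs, sq_abs, sq_abs]
    simp only [conj_trivial]
    field_simp
  simp only [h, Finset.sum_add_distrib, Finset.sum_sub_distrib, ← Finset.mul_sum]
  rw [shapeSpeed, ← vis, ← virial, ← inertia]
  ring

lemma sum_mass_inner_shapeVelocity (hm : ∀ k, 0 < m k) (q p : Fin 3 → ℂ) :
    ∑ k, m k * inner ℝ (shapeVelocity m q p k) (q k) = 0 := by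
  have h : ∀ k, m k * inner ℝ (shapeVelocity m q p k) (q k) =
      inertia m q * inner ℝ (q k) (p k) - virial q p * (m k * ‖q k‖ ^ 2) := by
    intro k
    have := (hm k).ne'
    simp only [shapeVelocity]
    rw [inner_sub_left, inner_smul_left, inner_smul_left, real_inner_self_eq_norm_sq,
      real_inner_comm (q k)]
    simp only [conj_trivial]
    field_simp
  simp only [h, Finset.sum_sub_distrib, ← Finset.mul_sum]
  rw [← virial, ← inertia]
  ring

lemma norm_sq_shapeVelocity_le (hm : ∀ k, 0 < m k) (q p : Fin 3 → ℂ) (k : Fin 3) :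
    ‖shapeVelocity m q p k‖ ^ 2 ≤ (m k)⁻¹ * (inertia m q * shapeSpeed m q p) := by
  rw [← sum_mass_inner_shapeVelocity_self hm, inv_mul_eq_div, le_div_iff₀ (hm k), mul_comm]
  exact Finset.single_le_sum (f := fun k => m k * ‖shapeVelocity m q p k‖ ^ 2)
    (fun i _ => mul_nonneg (hm i).le (sq_nonneg _)) (Finset.mem_univ k)

lemma unitShape_mem_configSpace (hm : ∀ k, 0 < m k) {z : Fin 3 → ℂ} (hz : z ∈ configSpace m) :
    unitShape m z ∈ configSpace m :=
  smul_mem_configSpace hz (inv_pos.2 (Real.sqrt_pos.2 (inertia_pos hm hz.1)))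

lemma inertia_unitShape (hm : ∀ k, 0 < m k) {z : Fin 3 → ℂ} (hz : Function.Injective z) :
    inertia m (unitShape m z) = 1 := by
  have h := inertia_pos hm hz
  rw [unitShape, inertia_smul, inv_pow, Real.sq_sqrt h.le, inv_mul_cancel₀ h.ne']

lemma configMeasure_unitShape (hm : ∀ k, 0 < m k) (a : ℝ) {z : Fin 3 → ℂ}
    (hz : Function.Injective z) : configMeasure m a (unitShape m z) = configMeasure m a z :=
  configMeasure_smul hm a z (inv_pos.2 (Real.sqrt_pos.2 (inertia_pos hm hz)))

lemma configMeasure_of_inertia_eq_one {z : Fin 3 → ℂ} (hz : inertia m z = 1) :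
    configMeasure m a z = potential m a z := by
  rw [configMeasure, hz, Real.one_rpow, mul_one]

namespace IsSolution

lemma eq_of_hasDerivAt_zero (h : IsSolution m a J q p) {f : ℝ → ℝ}
    (hf : ∀ t ∈ J, HasDerivAt f 0 t) {s t : ℝ} (hs : s ∈ J) (ht : t ∈ J) : f s = f t :=
  h.isOpen.is_const_of_deriv_eq_zero h.ordConnected.isPreconnected
    (fun x hx => (hf x hx).differentiableAt.differentiableWithinAt)
    (fun x hx => (hf x hx).deriv) hs ht

lemma hasDerivAt_inertia (h : IsSolution m a J q p) (hm : ∀ k, 0 < m k) (ht : t ∈ J) :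
    HasDerivAt (fun s => inertia m (q s)) (2 * virial (q t) (p t)) t := by
  simp only [inertia, virial]
  refine (HasDerivAt.fun_sum fun k _ =>
    (h.hasDerivAt_pos t ht k).norm_sq.const_mul (m k)).congr_deriv ?_
  rw [Finset.mul_sum]
  refine Finset.sum_congr rfl fun k _ => ?_
  have := (hm k).ne'
  rw [inner_smul_right]
  field_simp

/-- The Lagrange–Jacobi identity. -/
lemma hasDerivAt_virial (h : IsSolution m a J q p) (ha : a ≠ 0) (ht : t ∈ J) :
    HasDerivAt (fun s => virial (q s) (p s)) (vis m (p t) - a * potential m a (q t)) t := by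
  simp only [virial]
  refine (HasDerivAt.fun_sum fun k _ =>
    (h.hasDerivAt_pos t ht k).inner ℝ (h.hasDerivAt_mom t ht k)).congr_deriv ?_
  rw [Finset.sum_add_distrib, sum_inner_self_force ha (h.collisionFree t ht), vis, add_comm,
    sub_eq_add_neg]
  congr 1
  refine Finset.sum_congr rfl fun k _ => ?_
  rw [inner_smul_left, real_inner_self_eq_norm_sq, conj_trivial, inv_mul_eq_div]

lemma hasDerivAt_potential (h : IsSolution m a J q p) (ha : a ≠ 0) (ht : t ∈ J) :
    HasDerivAt (fun s => potential m a (q s))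
      (∑ k, inner ℝ ((m k)⁻¹ • p t k) (force m a (q t) k)) t :=
  ThreeBody.hasDerivAt_potential ha (h.hasDerivAt_pos t ht) (h.collisionFree t ht)

lemma hasDerivAt_vis (h : IsSolution m a J q p) (ht : t ∈ J) :
    HasDerivAt (fun s => vis m (p s))
      (2 * ∑ k, inner ℝ ((m k)⁻¹ • p t k) (force m a (q t) k)) t := by
  simp only [vis]
  refine (HasDerivAt.fun_sum fun k _ =>
    (h.hasDerivAt_mom t ht k).norm_sq.div_const (m k)).congr_deriv ?_
  rw [Finset.mul_sum]
  refine Finset.sum_congr rfl fun k _ => ?_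
  rw [inner_smul_left, conj_trivial]
  ring

lemma energy_eq_energy (h : IsSolution m a J q p) (ha : a ≠ 0) {s t : ℝ} (hs : s ∈ J)
    (ht : t ∈ J) : energy m a (q s) (p s) = energy m a (q t) (p t) := by
  refine h.eq_of_hasDerivAt_zero (f := fun s => energy m a (q s) (p s)) (fun t ht => ?_) hs ht
  simp only [energy_eq]
  exact (((h.hasDerivAt_vis ht).div_const 2).sub (h.hasDerivAt_potential ha ht)).congr_deriv
    (by ring)

/-- Constancy of the configurational measure, infinitesimally. -/
lemma inertia_mul_power (h : IsSolution m a J q p) (hm : ∀ k, 0 < m k) (ha : a ≠ 0) {μ : ℝ}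
    (hμ : ∀ t ∈ J, configMeasure m a (q t) = μ) (ht : t ∈ J) :
    inertia m (q t) * ∑ k, inner ℝ ((m k)⁻¹ • p t k) (force m a (q t) k)
      = -(a * potential m a (q t) * virial (q t) (p t)) := by
  have hI := inertia_pos hm (h.collisionFree t ht)
  have h1 := (h.hasDerivAt_potential ha ht).mul
    ((h.hasDerivAt_inertia hm ht).rpow_const (p := a / 2) (Or.inl hI.ne'))
  have h2 : HasDerivAt (fun _ : ℝ => μ) 0 t := hasDerivAt_const t μ
  have h3 := h1.unique (h2.congr_of_eventuallyEq
    (Filter.eventually_of_mem (h.isOpen.mem_nhds ht) fun s hs => hμ s hs))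
  have h4 : inertia m (q t) ^ (a / 2) = inertia m (q t) ^ (a / 2 - 1) * inertia m (q t) := by
    rw [← Real.rpow_add_one hI.ne']; ring_nf
  have h5 := Real.rpow_pos_of_pos hI (a / 2 - 1)
  rw [h4] at h3
  apply mul_left_cancel₀ h5.ne'
  linear_combination h3

/-- The terms in T cancel in κ', leaving twice I·U' + a·U·(virial), which is zero when μ is
constant. -/
lemma shapeSpeed_eq (h : IsSolution m a J q p) (hm : ∀ k, 0 < m k) (ha : a ≠ 0) {μ : ℝ}
    (hμ : ∀ t ∈ J, configMeasure m a (q t) = μ) {s t : ℝ} (hs : s ∈ J) (ht : t ∈ J) :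
    shapeSpeed m (q s) (p s) = shapeSpeed m (q t) (p t) := by
  refine h.eq_of_hasDerivAt_zero (f := fun s => shapeSpeed m (q s) (p s)) (fun t ht => ?_) hs ht
  simp only [shapeSpeed]
  refine (((h.hasDerivAt_vis ht).mul (h.hasDerivAt_inertia hm ht)).sub
    ((h.hasDerivAt_virial ha ht).pow 2)).congr_deriv ?_
  have := h.inertia_mul_power hm ha hμ ht
  push_cast
  linear_combination 2 * this

lemma hasDerivAt_unitShape (h : IsSolution m a J q p) (hm : ∀ k, 0 < m k) (ht : t ∈ J) :
    HasDerivAt (fun s => unitShape m (q s))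
      ((√(inertia m (q t)) ^ 3)⁻¹ • shapeVelocity m (q t) (p t)) t := by
  have hI := inertia_pos hm (h.collisionFree t ht)
  have hr := Real.sqrt_pos.2 hI
  have hr2 := Real.sq_sqrt hI.le
  refine hasDerivAt_pi.2 fun k => ?_
  refine ((((h.hasDerivAt_inertia hm ht).sqrt hI.ne').inv hr.ne').smul
    (h.hasDerivAt_pos t ht k)).congr_deriv ?_
  simp only [Pi.smul_apply, shapeVelocity, smul_sub, smul_smul]
  rw [sub_eq_add_neg, ← neg_smul]
  congr 2
  · rw [Pi.inv_apply, show inertia m (q t) = √(inertia m (q t)) ^ 2 from hr2.symm,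
      Real.sqrt_sq hr.le]
    field_simp
  · field_simp

/-- Sorted into multiples of w, of q and of the rescaled `defect`: the first two drop out when
paired with the defect. -/
lemma hasDerivAt_shapeVelocity (h : IsSolution m a J q p) (hm : ∀ k, 0 < m k) (ha : a ≠ 0)
    (ht : t ∈ J) (k : Fin 3) :
    HasDerivAt (fun s => shapeVelocity m (q s) (p s) k)
      ((virial (q t) (p t) * (inertia m (q t))⁻¹) • shapeVelocity m (q t) (p t) k
        + (virial (q t) (p t) ^ 2 * (inertia m (q t))⁻¹ - vis m (p t)) • q t k
        + (inertia m (q t) * (m k)⁻¹) • (force m a (q t) k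
          + (a * potential m a (q t) * (inertia m (q t))⁻¹ * m k) • q t k)) t := by
  have hI := inertia_pos hm (h.collisionFree t ht)
  have hmk := (hm k).ne'
  refine ((((h.hasDerivAt_inertia hm ht).mul_const (m k)⁻¹).smul (h.hasDerivAt_mom t ht k)).sub
    ((h.hasDerivAt_virial ha ht).smul (h.hasDerivAt_pos t ht k))).congr_deriv ?_
  have hI' : (inertia m (q t) : ℂ) ≠ 0 := by exact_mod_cast hI.ne'
  have hmk' : (m k : ℂ) ≠ 0 := by exact_mod_cast hmk
  simp only [shapeVelocity, Complex.real_smul]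
  push_cast
  field_simp
  ring

end IsSolution

end ThreeBody

/-! ### The gradient of the configurational measure along a solution. -/

namespace ThreeBody

variable {m : Fin 3 → ℝ} {a : ℝ} {J : Set ℝ} {q p : ℝ → Fin 3 → ℂ} {t : ℝ}

/-- Unit configurations whose mutual distances are at least `δ`. -/
def separatedShapes (m : Fin 3 → ℝ) (δ : ℝ) : Set (Fin 3 → ℂ) :=
  {z | inertia m z = 1 ∧ ∀ j k, j ≠ k → δ ≤ ‖z j - z k‖}

lemma injective_of_mem_separatedShapes {δ : ℝ} (hδ : 0 < δ) {z : Fin 3 → ℂ}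
    (hz : z ∈ separatedShapes m δ) : Function.Injective z := by
  intro j k hjk
  by_contra hne
  have := hz.2 j k hne
  rw [hjk, sub_self, norm_zero] at this
  exact absurd hδ this.not_gt

lemma isClosed_separated (δ : ℝ) :
    IsClosed {z : Fin 3 → ℂ | ∀ j k, j ≠ k → δ ≤ ‖z j - z k‖} := by
  have h : {z : Fin 3 → ℂ | ∀ j k, j ≠ k → δ ≤ ‖z j - z k‖}
      = ⋂ j, ⋂ k, ⋂ _ : j ≠ k, {z | δ ≤ ‖z j - z k‖} := by
    ext z; simp
  rw [h]
  refine isClosed_iInter fun j => isClosed_iInter fun k => isClosed_iInter fun _ => ?_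
  exact isClosed_le continuous_const (by fun_prop)

lemma isCompact_separatedShapes (hm : ∀ k, 0 < m k) (δ : ℝ) :
    IsCompact (separatedShapes m δ) := by
  refine Metric.isCompact_of_isClosed_isBounded ?_ ?_
  · refine (isClosed_singleton.preimage (continuous_inertia m)).inter ?_
    exact isClosed_separated δ
  · obtain ⟨i, hi⟩ := Finite.exists_min m
    refine (Metric.isBounded_closedBall (x := (0 : Fin 3 → ℂ)) (r := √(m i)⁻¹)).subset ?_
    intro z hz
    rw [mem_closedBall_zero_iff, pi_norm_le_iff_of_nonneg (Real.sqrt_nonneg _)]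
    intro k
    apply Real.le_sqrt_of_sq_le
    have h1 : m k * ‖z k‖ ^ 2 ≤ 1 := by
      rw [← hz.1]
      exact Finset.single_le_sum (f := fun k => m k * ‖z k‖ ^ 2)
        (fun j _ => mul_nonneg (hm j).le (sq_nonneg _)) (Finset.mem_univ k)
    rw [← one_div, le_div_iff₀ (hm i), mul_comm]
    exact (mul_le_mul_of_nonneg_right (hi k) (sq_nonneg _)).trans h1

lemma exists_norm_fderiv_force_le (hm : ∀ k, 0 < m k) (a : ℝ) {δ : ℝ} (hδ : 0 < δ) :
    ∃ B, ∀ z ∈ separatedShapes m δ, ∀ k, ‖fderiv ℝ (fun z => force m a z k) z‖ ≤ B := by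
  have h : ∀ k, ∃ B, ∀ z ∈ separatedShapes m δ, ‖fderiv ℝ (fun z => force m a z k) z‖ ≤ B := by
    intro k
    refine (isCompact_separatedShapes hm δ).exists_bound_of_continuousOn fun z hz => ?_
    exact ((contDiffAt_force m a (injective_of_mem_separatedShapes hδ hz) 1 k).continuousAt_fderiv
      one_ne_zero).continuousWithinAt
  choose B hB using h
  exact ⟨∑ k, |B k|, fun z hz k => (hB k z hz).trans ((le_abs_self _).trans
    (Finset.single_le_sum (f := fun k => |B k|) (fun _ _ => abs_nonneg _) (Finset.mem_univ k)))⟩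

/-- The vector `g_k(z) + a μ m_k z_k` that vanishes at central configurations of measure `μ`. -/
noncomputable def defect (m : Fin 3 → ℝ) (a μ : ℝ) (z : Fin 3 → ℂ) (k : Fin 3) : ℂ :=
  force m a z k + (a * μ * m k) • z k

lemma defect_unitShape (hm : ∀ k, 0 < m k) {z : Fin 3 → ℂ} (hz : Function.Injective z)
    (k : Fin 3) : defect m a (configMeasure m a z) (unitShape m z) k
      = √(inertia m z) ^ (a + 1) • defect m a (potential m a z * (inertia m z)⁻¹) z k := by
  have hI := inertia_pos hm hz
  have hr := Real.sqrt_pos.2 hI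
  have hr2 := Real.sq_sqrt hI.le
  have hpow : inertia m z ^ (a / 2) = √(inertia m z) ^ (a + 1) * (√(inertia m z))⁻¹ := by
    rw [Real.sqrt_eq_rpow, ← Real.rpow_neg hI.le, ← Real.rpow_mul hI.le, ← Real.rpow_add hI]
    ring_nf
  rw [defect, defect, unitShape, force_smul m a z (inv_pos.2 hr), Real.inv_rpow hr.le, inv_inv,
    smul_add, Pi.smul_apply, smul_smul, smul_smul, configMeasure, hpow]
  congr 2
  have hinv : (√(inertia m z))⁻¹ * (√(inertia m z))⁻¹ = (inertia m z)⁻¹ := by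
    rw [← mul_inv, ← sq, hr2]
  rw [← hinv]
  ring

/-- The measure is invariant under dilations, so its gradient is orthogonal to them. -/
lemma sum_inner_self_defect (hm : ∀ k, 0 < m k) (ha : a ≠ 0) {z : Fin 3 → ℂ}
    (hz : Function.Injective z) :
    ∑ k, inner ℝ (z k) (defect m a (potential m a z * (inertia m z)⁻¹) z k) = 0 := by
  have hI := inertia_pos hm hz
  have h : ∀ k, inner ℝ (z k) (defect m a (potential m a z * (inertia m z)⁻¹) z k)
      = inner ℝ (z k) (force m a z k)
        + a * potential m a z * (inertia m z)⁻¹ * (m k * ‖z k‖ ^ 2) := by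
    intro k
    rw [defect, inner_add_right, inner_smul_right, real_inner_self_eq_norm_sq]
    ring
  simp only [h, Finset.sum_add_distrib, ← Finset.mul_sum]
  rw [sum_inner_self_force ha hz, ← inertia, mul_assoc _ _ (inertia m z), inv_mul_cancel₀ hI.ne']
  ring

namespace IsSolution

/-- The unit shape moves inside a level set of μ, so its velocity is orthogonal to the gradient. -/
lemma sum_inner_shapeVelocity_defect (h : IsSolution m a J q p) (hm : ∀ k, 0 < m k) (ha : a ≠ 0)
    {μ : ℝ} (hμ : ∀ t ∈ J, configMeasure m a (q t) = μ) (ht : t ∈ J) :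
    ∑ k, inner ℝ (shapeVelocity m (q t) (p t) k)
      (defect m a μ (unitShape m (q t)) k) = 0 := by
  have hz := h.collisionFree t ht
  have e : ∀ k, inner ℝ (shapeVelocity m (q t) (p t) k) (defect m a μ (unitShape m (q t)) k)
      = √(inertia m (q t)) ^ (a + 1) *
        (inertia m (q t) * inner ℝ ((m k)⁻¹ • p t k) (force m a (q t) k)
        - virial (q t) (p t) * inner ℝ (q t k) (force m a (q t) k)
        + a * (potential m a (q t) * (inertia m (q t))⁻¹) *
          (m k * inner ℝ (shapeVelocity m (q t) (p t) k) (q t k))) := by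
    intro k
    rw [← hμ t ht, defect_unitShape hm hz, inner_smul_right, defect, inner_add_right,
      inner_smul_right]
    congr 1
    have : inner ℝ (shapeVelocity m (q t) (p t) k) (force m a (q t) k)
        = inertia m (q t) * inner ℝ ((m k)⁻¹ • p t k) (force m a (q t) k)
        - virial (q t) (p t) * inner ℝ (q t k) (force m a (q t) k) := by
      simp only [shapeVelocity, ← smul_smul, inner_sub_left]
      rw [real_inner_smul_left, real_inner_smul_left (q t k)]
    rw [this]
    ring
  simp only [e, ← Finset.mul_sum, Finset.sum_add_distrib, Finset.sum_sub_distrib]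
  rw [sum_mass_inner_shapeVelocity hm, h.inertia_mul_power hm ha hμ ht, sum_inner_self_force ha hz]
  ring

/-- Obtained by differentiating `sum_inner_shapeVelocity_defect`: in w' only the component along the
gradient survives, which produces its square. -/
lemma sum_norm_sq_defect (h : IsSolution m a J q p) (hm : ∀ k, 0 < m k) (ha : a ≠ 0)
    {μ : ℝ} (hμ : ∀ t ∈ J, configMeasure m a (q t) = μ) (ht : t ∈ J) {v : Fin 3 → ℂ}
    (hv : ∀ k, HasDerivAt (fun s => defect m a μ (unitShape m (q s)) k) (v k) t) :
    √(inertia m (q t)) ^ (1 - a) * ∑ k, (m k)⁻¹ * ‖defect m a μ (unitShape m (q t)) k‖ ^ 2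
      = -∑ k, inner ℝ (shapeVelocity m (q t) (p t) k) (v k) := by
  have hz := h.collisionFree t ht
  have hI := inertia_pos hm hz
  have hr := Real.sqrt_pos.2 hI
  have hr2 := Real.sq_sqrt hI.le
  have h1 := HasDerivAt.fun_sum (u := Finset.univ) fun k _ =>
    (h.hasDerivAt_shapeVelocity hm ha ht k).inner ℝ (hv k)
  have h0 := h1.unique ((hasDerivAt_const t (0 : ℝ)).congr_of_eventuallyEq
    (Filter.eventually_of_mem (h.isOpen.mem_nhds ht) fun s hs =>
      h.sum_inner_shapeVelocity_defect hm ha hμ hs))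
  have hd : ∀ k, force m a (q t) k
      + (a * potential m a (q t) * (inertia m (q t))⁻¹ * m k) • q t k
      = (√(inertia m (q t)) ^ (a + 1))⁻¹ • defect m a μ (unitShape m (q t)) k := by
    intro k
    rw [← hμ t ht, defect_unitShape hm hz, smul_smul,
      inv_mul_cancel₀ (Real.rpow_pos_of_pos hr _).ne', one_smul, defect, mul_assoc a]
  have hpow : inertia m (q t) * (√(inertia m (q t)) ^ (a + 1))⁻¹ = √(inertia m (q t)) ^ (1 - a) := by
    rw [← Real.rpow_neg hr.le]
    nth_rw 1 [← hr2]
    rw [← Real.rpow_two, ← Real.rpow_add hr]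
    ring_nf
  have hself : ∑ k, inner ℝ (q t k) (defect m a μ (unitShape m (q t)) k) = 0 := by
    simp only [← hμ t ht, defect_unitShape hm hz, inner_smul_right, ← Finset.mul_sum,
      sum_inner_self_defect hm ha hz, mul_zero]
  have e : ∀ k, inner ℝ ((virial (q t) (p t) * (inertia m (q t))⁻¹) •
        shapeVelocity m (q t) (p t) k
        + (virial (q t) (p t) ^ 2 * (inertia m (q t))⁻¹ - vis m (p t)) • q t k
        + (inertia m (q t) * (m k)⁻¹) • (force m a (q t) k
          + (a * potential m a (q t) * (inertia m (q t))⁻¹ * m k) • q t k))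
        (defect m a μ (unitShape m (q t)) k)
      = (virial (q t) (p t) * (inertia m (q t))⁻¹) *
          inner ℝ (shapeVelocity m (q t) (p t) k) (defect m a μ (unitShape m (q t)) k)
        + (virial (q t) (p t) ^ 2 * (inertia m (q t))⁻¹ - vis m (p t)) *
          inner ℝ (q t k) (defect m a μ (unitShape m (q t)) k)
        + √(inertia m (q t)) ^ (1 - a) *
          ((m k)⁻¹ * ‖defect m a μ (unitShape m (q t)) k‖ ^ 2) := by
    intro k
    rw [hd, inner_add_left, inner_add_left, smul_smul, real_inner_smul_left,
      real_inner_smul_left, real_inner_smul_left, real_inner_self_eq_norm_sq, ← hpow]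
    ring
  simp only [e, Finset.sum_add_distrib, ← Finset.mul_sum, hself,
    h.sum_inner_shapeVelocity_defect hm ha hμ ht] at h0
  linarith

lemma unitShape_mem_separatedShapes (h : IsSolution m a J q p) (hm : ∀ k, 0 < m k) {μ : ℝ}
    (hμ : ∀ t ∈ J, configMeasure m a (q t) = μ) {δ : ℝ}
    (hδ : ∀ q : Fin 3 → ℂ, Function.Injective q → potential m a q ≤ μ →
      ∀ j k, j ≠ k → δ ≤ ‖q j - q k‖) (ht : t ∈ J) :
    unitShape m (q t) ∈ separatedShapes m δ := by
  have hz := h.collisionFree t ht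
  have h1 := inertia_unitShape hm hz
  refine ⟨h1, hδ _ ?_ ?_⟩
  · intro j k hjk
    exact hz (smul_right_injective ℂ
      (inv_pos.2 (Real.sqrt_pos.2 (inertia_pos hm hz))).ne' hjk)
  · rw [← configMeasure_of_inertia_eq_one h1, configMeasure_unitShape hm a hz, hμ t ht]

/-- Large solutions of constant configurational measure have almost central shape. -/
lemma exists_norm_sq_defect_le (h : IsSolution m a J q p) (hm : ∀ k, 0 < m k) (ha : a ≠ 0)
    {μ : ℝ} (hμ : ∀ t ∈ J, configMeasure m a (q t) = μ) {δ : ℝ} (hδ0 : 0 < δ)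
    (hδ : ∀ q : Fin 3 → ℂ, Function.Injective q → potential m a q ≤ μ →
      ∀ j k, j ≠ k → δ ≤ ‖q j - q k‖) :
    ∃ C, ∀ t ∈ J, ∀ k,
      ‖defect m a μ (unitShape m (q t)) k‖ ^ 2 ≤ C * √(inertia m (q t)) ^ (a - 2) := by
  obtain ⟨B, hB⟩ := exists_norm_fderiv_force_le hm a hδ0
  obtain ⟨s, hs⟩ := h.nonempty
  set κ := shapeSpeed m (q s) (p s) with hκ
  obtain ⟨i, hi⟩ := Finite.exists_min m
  obtain ⟨l, hl⟩ := Finite.exists_max m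
  obtain ⟨B', hB'0, hB'⟩ : ∃ B', 0 ≤ B' ∧ ∀ k, B + |a * μ * m k| ≤ B' := by
    refine ⟨|B| + ∑ k, |a * μ * m k|, by positivity, fun k => ?_⟩
    exact add_le_add (le_abs_self _) (Finset.single_le_sum (f := fun k => |a * μ * m k|)
      (fun _ _ => abs_nonneg _) (Finset.mem_univ k))
  refine ⟨m l * (3 * (B' * ((m i)⁻¹ * κ))), fun t ht k => ?_⟩
  have hz := h.collisionFree t ht
  have hI := inertia_pos hm hz
  have hr := Real.sqrt_pos.2 hI
  have hr2 := Real.sq_sqrt hI.le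
  have hS := h.unitShape_mem_separatedShapes hm hμ hδ ht
  set w := shapeVelocity m (q t) (p t) with hw
  set r := √(inertia m (q t)) with hrdef
  have hκ0 : 0 ≤ inertia m (q t) * κ := by
    rw [hκ, h.shapeSpeed_eq hm ha hμ hs ht, ← sum_mass_inner_shapeVelocity_self hm]
    exact Finset.sum_nonneg fun k _ => mul_nonneg (hm k).le (sq_nonneg _)
  have hwn : ‖w‖ ^ 2 ≤ (m i)⁻¹ * (inertia m (q t) * κ) := by
    have h0 : 0 ≤ (m i)⁻¹ * (inertia m (q t) * κ) := mul_nonneg (inv_pos.2 (hm i)).le hκ0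
    apply (Real.le_sqrt (norm_nonneg _) h0).1
    rw [pi_norm_le_iff_of_nonneg (Real.sqrt_nonneg _)]
    intro j
    apply Real.le_sqrt_of_sq_le
    have := norm_sq_shapeVelocity_le hm (q t) (p t) j
    rw [← h.shapeSpeed_eq hm ha hμ hs ht] at this
    exact this.trans (mul_le_mul_of_nonneg_right (inv_anti₀ (hm i) (hi j)) hκ0)
  have hQ := h.hasDerivAt_unitShape hm ht
  rw [← hw, ← hrdef] at hQ
  have hv : ∀ k, HasDerivAt (fun s => defect m a μ (unitShape m (q s)) k)
      (fderiv ℝ (fun z => force m a z k) (unitShape m (q t)) ((r ^ 3)⁻¹ • w)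
        + (a * μ * m k) • ((r ^ 3)⁻¹ • w) k) t := by
    intro k
    have hd := (contDiffAt_force m a (injective_of_mem_separatedShapes hδ0 hS) 1 k).differentiableAt
      one_ne_zero
    exact (hd.hasFDerivAt.comp_hasDerivAt t hQ).add ((hasDerivAt_pi.1 hQ k).const_smul (a * μ * m k))
  have hvn : ∀ k, ‖fderiv ℝ (fun z => force m a z k) (unitShape m (q t)) ((r ^ 3)⁻¹ • w)
        + (a * μ * m k) • ((r ^ 3)⁻¹ • w) k‖ ≤ B' * ((r ^ 3)⁻¹ * ‖w‖) := by
    intro k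
    have hn : ‖(r ^ 3)⁻¹ • w‖ = (r ^ 3)⁻¹ * ‖w‖ := by
      rw [norm_smul, Real.norm_of_nonneg (by positivity)]
    have n1 := ContinuousLinearMap.le_of_opNorm_le _ (hB _ hS k) ((r ^ 3)⁻¹ • w)
    have n2 := norm_le_pi_norm ((r ^ 3)⁻¹ • w) k
    have n3 := mul_le_mul_of_nonneg_left n2 (abs_nonneg (a * μ * m k))
    calc _ ≤ _ := norm_add_le _ _
      _ ≤ B * ‖(r ^ 3)⁻¹ • w‖ + |a * μ * m k| * ‖(r ^ 3)⁻¹ • w‖ := by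
        rw [norm_smul (a * μ * m k), Real.norm_eq_abs]
        exact add_le_add n1 n3
      _ = (B + |a * μ * m k|) * ‖(r ^ 3)⁻¹ • w‖ := by ring
      _ ≤ _ := by
        rw [hn]
        exact mul_le_mul_of_nonneg_right (hB' k) (by positivity)
  have hmain := h.sum_norm_sq_defect hm ha hμ ht hv
  rw [← hrdef] at hmain
  -- One factor w comes from the pairing and one from the derivative v = O(|w|/r³); with |w|² =
  -- O(κr²) the product is O(1/r).
  have hle : r ^ (1 - a) * ∑ k, (m k)⁻¹ * ‖defect m a μ (unitShape m (q t)) k‖ ^ 2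
      ≤ 3 * (B' * ((m i)⁻¹ * κ)) * r⁻¹ := by
    rw [hmain, ← Finset.sum_neg_distrib]
    calc _ ≤ ∑ _k : Fin 3, ‖w‖ * (B' * ((r ^ 3)⁻¹ * ‖w‖)) := by
          refine Finset.sum_le_sum fun k _ => ?_
          refine (neg_le_abs _).trans ((abs_real_inner_le_norm _ _).trans ?_)
          exact mul_le_mul (norm_le_pi_norm w k) (hvn k) (norm_nonneg _) (norm_nonneg _)
      _ = 3 * (B' * ((r ^ 3)⁻¹ * ‖w‖ ^ 2)) := by
          rw [Finset.sum_const, Finset.card_univ, Fintype.card_fin, nsmul_eq_mul]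
          push_cast
          ring
      _ ≤ 3 * (B' * ((r ^ 3)⁻¹ * ((m i)⁻¹ * (inertia m (q t) * κ)))) := by gcongr
      _ = _ := by
          rw [← hr2]
          field_simp
  have hpow : r ^ (1 - a) * r ^ (a - 2) = r⁻¹ := by
    rw [← Real.rpow_add hr, ← Real.rpow_neg_one]; ring_nf
  have hp1 := Real.rpow_pos_of_pos hr (1 - a)
  have hsum : ∑ k, (m k)⁻¹ * ‖defect m a μ (unitShape m (q t)) k‖ ^ 2
      ≤ 3 * (B' * ((m i)⁻¹ * κ)) * r ^ (a - 2) := by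
    apply le_of_mul_le_mul_left _ hp1
    calc _ ≤ _ := hle
      _ = _ := by rw [← hpow]; ring
  have hk := (Finset.single_le_sum (f := fun k => (m k)⁻¹ *
    ‖defect m a μ (unitShape m (q t)) k‖ ^ 2)
    (fun j _ => mul_nonneg (inv_pos.2 (hm j)).le (sq_nonneg _)) (Finset.mem_univ k)).trans hsum
  rw [inv_mul_eq_div, div_le_iff₀ (hm k)] at hk
  have h0 : 0 ≤ 3 * (B' * ((m i)⁻¹ * κ)) * r ^ (a - 2) :=
    (Finset.sum_nonneg fun j _ => mul_nonneg (inv_pos.2 (hm j)).le (sq_nonneg _)).trans hsum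
  calc _ ≤ _ := hk
    _ ≤ 3 * (B' * ((m i)⁻¹ * κ)) * r ^ (a - 2) * m l := mul_le_mul_of_nonneg_left (hl k) h0
    _ = _ := by ring

end IsSolution

end ThreeBody

/-! ### Continuation for all future time. -/

open Filter Topology in
/-- A solution of an autonomous `C¹` equation with bounded speed, staying in a closed set on which
the vector field is regular, extends past the right endpoint of its interval. -/
lemma exists_extension_of_bounded_speed {E : Type*} [NormedAddCommGroup E] [NormedSpace ℝ E]
    [CompleteSpace E] {F : E → E} {K U : Set E} (hK : IsClosed K) (hU : IsOpen U) (hKU : K ⊆ U)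
    (hF : ∀ z ∈ U, ContDiffAt ℝ 1 F z) {x : ℝ → E} {b c C : ℝ} (hcb : c < b)
    (hx : ∀ t ∈ Set.Ioo c b, HasDerivAt x (F (x t)) t) (hxK : ∀ t ∈ Set.Ioo c b, x t ∈ K)
    (hC : ∀ t ∈ Set.Ioo c b, ‖F (x t)‖ ≤ C) :
    ∃ ε > 0, ∃ y : ℝ → E, (∀ t < b, y t = x t) ∧
      (∀ t ∈ Set.Ioo c (b + ε), HasDerivAt y (F (y t)) t) ∧ ∀ t ∈ Set.Ioo c (b + ε), y t ∈ U := by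
  have hmem : Set.Ioo c b ∈ 𝓝[<] b := Ioo_mem_nhdsLT hcb
  -- Bounded speed makes x Lipschitz, so by completeness it has a limit at b, where a local solution
  -- can be attached.
  have hlip : LipschitzOnWith C.toNNReal x (Set.Ioo c b) :=
    (convex_Ioo c b).lipschitzOnWith_of_nnnorm_hasDerivWithin_le
      (fun t ht => (hx t ht).hasDerivWithinAt)
      (fun t ht => by
        rw [← NNReal.coe_le_coe, coe_nnnorm]
        exact (hC t ht).trans (Real.le_coe_toNNReal C))
  have hcauchy : Cauchy (map x (𝓝[<] b)) :=
    (cauchy_nhds.mono nhdsWithin_le_nhds).map_of_le hlip.uniformContinuousOn (le_principal_iff.2 hmem)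
  obtain ⟨z, hz⟩ := cauchy_map_iff_exists_tendsto.1 hcauchy
  have hzK : z ∈ K := hK.mem_of_tendsto hz (eventually_of_mem hmem hxK)
  obtain ⟨α, hαb, ε₁, hε₁, hα⟩ :=
    (hF z (hKU hzK)).exists_forall_mem_closedBall_exists_eq_forall_mem_Ioo_hasDerivAt₀ b
  have hαc : ContinuousAt α b := (hα b ⟨by linarith, by linarith⟩).continuousAt
  have hαU : ∀ᶠ t in 𝓝 b, α t ∈ U := hαc (hU.mem_nhds (hαb.symm ▸ hKU hzK))
  obtain ⟨ε₂, hε₂, hαU⟩ := Metric.eventually_nhds_iff.1 hαU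
  set y : ℝ → E := fun t => if t < b then x t else α t with hy
  have hy1 : ∀ t < b, y t = x t := fun t ht => if_pos ht
  have hy2 : ∀ t, b ≤ t → y t = α t := fun t ht => if_neg ht.not_gt
  have hyb : y b = z := (hy2 b le_rfl).trans hαb
  refine ⟨min ε₁ ε₂, lt_min hε₁ hε₂, y, hy1, fun t ht => ?_, fun t ht => ?_⟩
  · rcases lt_trichotomy t b with htb | rfl | htb
    · rw [hy1 t htb]
      exact (hx t ⟨ht.1, htb⟩).congr_of_eventuallyEq
        (eventually_of_mem (Iio_mem_nhds htb) hy1)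
    · rw [hyb]
      have hyx : Set.EqOn y x (Set.Ioo c t) := fun s hs => hy1 s hs.2
      have hd : ∀ s ∈ Set.Ioo c t, HasDerivAt y (F (x s)) s := fun s hs =>
        (hx s hs).congr_of_eventuallyEq (eventually_of_mem (Iio_mem_nhds hs.2) hy1)
      -- At the seam the left derivative is the limit of the derivatives F (x s); the right one
      -- comes from the local solution, and both equal F z.
      have hleft : HasDerivWithinAt y (F z) (Set.Iic t) t := by
        refine hasDerivWithinAt_Iic_of_tendsto_deriv (s := Set.Ioo c t)
          (fun s hs => (hd s hs).differentiableAt.differentiableWithinAt) ?_ hmem ?_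
        · have : Tendsto x (𝓝[Set.Ioo c t] t) (𝓝 z) :=
            hz.mono_left (nhdsWithin_mono _ fun s hs => hs.2)
          rw [ContinuousWithinAt, hyb]
          exact this.congr' (eventually_of_mem self_mem_nhdsWithin fun s hs => (hyx hs).symm)
        · exact ((hF z (hKU hzK)).continuousAt.tendsto.comp hz).congr'
            (eventually_of_mem hmem fun s hs => (hd s hs).deriv.symm)
      have hright : HasDerivWithinAt y (F z) (Set.Ici t) t := by
        have h := (hα t ⟨by linarith, by linarith⟩).hasDerivWithinAt (s := Set.Ici t)
        rw [hαb] at h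
        exact h.congr (fun s hs => hy2 s hs) (hy2 t le_rfl)
      have h := hleft.union hright
      rwa [Set.Iic_union_Ici, hasDerivWithinAt_univ] at h
    · rw [hy2 t htb.le]
      exact (hα t ⟨by linarith, by linarith [ht.2, min_le_left ε₁ ε₂]⟩).congr_of_eventuallyEq
        (eventually_of_mem (Ioi_mem_nhds htb) fun s hs => hy2 s (le_of_lt hs))
  · rcases lt_or_ge t b with htb | htb
    · rw [hy1 t htb]
      exact hKU (hxK t ⟨ht.1, htb⟩)
    · rw [hy2 t htb]
      refine hαU ?_
      rw [Real.dist_eq, abs_of_nonneg (by linarith)]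
      linarith [ht.2, min_le_right ε₁ ε₂]

namespace ThreeBody

variable {m : Fin 3 → ℝ} {a : ℝ} {J : Set ℝ} {q p : ℝ → Fin 3 → ℂ} {t : ℝ}

lemma exists_norm_force_le (m : Fin 3 → ℝ) (ha : 0 < a) {δ : ℝ} (hδ : 0 < δ) :
    ∃ C, ∀ z : Fin 3 → ℂ, (∀ j k, j ≠ k → δ ≤ ‖z j - z k‖) → ‖force m a z‖ ≤ C := by
  refine ⟨∑ k, ∑ j, |m j * m k| / δ ^ (a + 1), fun z hz => ?_⟩
  have hpos : ∀ k j : Fin 3, 0 ≤ |m j * m k| / δ ^ (a + 1) := fun k j =>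
    div_nonneg (abs_nonneg _) (Real.rpow_pos_of_pos hδ _).le
  have hpos' : ∀ k : Fin 3, 0 ≤ ∑ j, |m j * m k| / δ ^ (a + 1) := fun k =>
    Finset.sum_nonneg fun j _ => hpos k j
  rw [pi_norm_le_iff_of_nonneg (Finset.sum_nonneg fun k _ => hpos' k)]
  intro k
  refine le_trans ?_ (Finset.single_le_sum (f := fun k => ∑ j, |m j * m k| / δ ^ (a + 1))
    (fun k _ => hpos' k) (Finset.mem_univ k))
  rw [force]
  refine (norm_sum_le _ _).trans (le_trans (Finset.sum_le_sum fun j hj => ?_)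
    (Finset.sum_le_sum_of_subset_of_nonneg (Finset.erase_subset k Finset.univ)
      fun j _ _ => hpos k j))
  have h := hz j k (Finset.ne_of_mem_erase hj)
  have hr : 0 < ‖z j - z k‖ := hδ.trans_le h
  have hpow : ‖z j - z k‖ ^ (a + 2) = ‖z j - z k‖ ^ (a + 1) * ‖z j - z k‖ := by
    rw [← Real.rpow_add_one hr.ne']; ring_nf
  have hp1 := Real.rpow_pos_of_pos hr (a + 1)
  rw [norm_smul, norm_div, Real.norm_eq_abs, Real.norm_of_nonneg (Real.rpow_nonneg hr.le _), hpow]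
  calc _ = |m j * m k| / ‖z j - z k‖ ^ (a + 1) := by field_simp
    _ ≤ _ := by
      gcongr

/-- A maximal solution whose mutual distances are bounded below and whose momenta are bounded
exists for all future time. -/
lemma IsMaximalSolution.Ici_subset (h : IsMaximalSolution m a J q p) (ha : 0 < a) {δ P t₀ : ℝ}
    (ht₀ : t₀ ∈ J) (hδ : 0 < δ) (hq : ∀ t ∈ J, ∀ j k, j ≠ k → δ ≤ ‖q t j - q t k‖)
    (hp : ∀ t ∈ J, ‖p t‖ ≤ P) : Set.Ici t₀ ⊆ J := by
  obtain ⟨hs, hmax⟩ := h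
  have hunb : ¬ BddAbove J := by
    intro hbdd
    set b := sSup J with hb
    have hlub : IsLUB J b := isLUB_csSup hs.nonempty hbdd
    have hbJ : b ∉ J := by
      intro hbJ
      obtain ⟨ε, hε, hball⟩ := Metric.isOpen_iff.1 hs.isOpen b hbJ
      have : b + ε / 2 ∈ J := hball (by
        rw [Metric.mem_ball, Real.dist_eq, add_sub_cancel_left, abs_of_pos (by positivity)]
        linarith)
      linarith [hlub.1 this]
    have hlt : ∀ t ∈ J, t < b := fun t ht => lt_of_le_of_ne (hlub.1 ht) fun e => hbJ (e ▸ ht)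
    have hsub : Set.Ioo t₀ b ⊆ J := by
      intro t ht
      obtain ⟨s, hsJ, hts⟩ := (lt_isLUB_iff hlub).1 ht.2
      exact hs.ordConnected.out ht₀ hsJ ⟨ht.1.le, hts.le⟩
    set F : (Fin 3 → ℂ) × (Fin 3 → ℂ) → (Fin 3 → ℂ) × (Fin 3 → ℂ) :=
      fun z => (fun k => (m k)⁻¹ • z.2 k, force m a z.1) with hF
    obtain ⟨C, hC⟩ := exists_norm_force_le m ha hδ
    have hvel : ∀ t ∈ J, ‖fun k => (m k)⁻¹ • p t k‖ ≤ (∑ k, |(m k)⁻¹|) * P := by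
      intro t ht
      have hP0 : 0 ≤ P := (norm_nonneg _).trans (hp t ht)
      rw [pi_norm_le_iff_of_nonneg (by positivity)]
      intro k
      rw [norm_smul, Real.norm_eq_abs]
      exact mul_le_mul (Finset.single_le_sum (f := fun k => |(m k)⁻¹|)
        (fun _ _ => abs_nonneg _) (Finset.mem_univ k)) ((norm_le_pi_norm _ k).trans (hp t ht))
        (norm_nonneg _) (by positivity)
    have hxder : ∀ t ∈ J, HasDerivAt (fun s => (q s, p s)) (F (q t, p t)) t := fun t ht =>
      (hasDerivAt_pi.2 (hs.hasDerivAt_pos t ht)).prodMk (hasDerivAt_pi.2 (hs.hasDerivAt_mom t ht))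
    obtain ⟨ε, hε, y, hyx, hyd, hyU⟩ := exists_extension_of_bounded_speed (F := F)
      (K := Prod.fst ⁻¹' {z | ∀ j k, j ≠ k → δ ≤ ‖z j - z k‖})
      (U := Prod.fst ⁻¹' {z | Function.Injective z}) (x := fun s => (q s, p s))
      (c := t₀) (b := b) (C := max ((∑ k, |(m k)⁻¹|) * P) C)
      ((isClosed_separated δ).preimage continuous_fst) (isOpen_injective.preimage continuous_fst)
      (fun z hz j k hjk => by
        by_contra hne
        have := hz j k hne
        rw [hjk, sub_self, norm_zero] at this
        exact absurd hδ this.not_gt)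
      (fun z hz => by
        refine ContDiffAt.prodMk ?_ ?_
        · exact contDiffAt_pi.2 fun k => ContDiffAt.const_smul _
            ((contDiff_apply ℝ ℂ k).comp contDiff_snd).contDiffAt
        · exact contDiffAt_pi.2 fun k =>
            (contDiffAt_force m a hz 1 k).comp z contDiff_fst.contDiffAt)
      (hlt t₀ ht₀) (fun t ht => hxder t (hsub ht)) (fun t ht => hq t (hsub ht))
      (fun t ht => by
        rw [Prod.norm_def]
        exact max_le_max (hvel t (hsub ht)) (hC _ (hq t (hsub ht))))
    have hyd' : ∀ t ∈ J ∪ Set.Ioo t₀ (b + ε), HasDerivAt y (F (y t)) t := by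
      rintro t (ht | ht)
      · rw [hyx t (hlt t ht)]
        exact (hxder t ht).congr_of_eventuallyEq
          (Filter.eventually_of_mem (Iio_mem_nhds (hlt t ht)) hyx)
      · exact hyd t ht
    -- Maximality makes the enlarged interval equal to J, although it contains b, the supremum
    -- missing from J.
    have hJ' := hmax (J ∪ Set.Ioo t₀ (b + ε)) (fun t => (y t).1) (fun t => (y t).2)
      { isOpen := hs.isOpen.union isOpen_Ioo
        ordConnected := by
          obtain ⟨t₁, ht₁, h01, -⟩ : ∃ t₁ ∈ J, t₀ < t₁ ∧ t₁ ≤ b := by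
            obtain ⟨s, hsJ, h1, h2⟩ := hlub.exists_between (hlt t₀ ht₀)
            exact ⟨s, hsJ, h1, h2⟩
          exact (IsPreconnected.union (t := Set.Ioo t₀ (b + ε)) t₁ ht₁ ⟨h01, (hlt t₁ ht₁).trans (lt_add_of_pos_right b hε)⟩
            hs.ordConnected.isPreconnected isPreconnected_Ioo).ordConnected
        nonempty := hs.nonempty.inl
        collisionFree := by
          rintro t (ht | ht)
          · have := hs.collisionFree t ht
            rwa [hyx t (hlt t ht)]
          · exact hyU t ht
        hasDerivAt_pos := fun t ht k => hasDerivAt_pi.1 (hyd' t ht).fst k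
        hasDerivAt_mom := fun t ht k => hasDerivAt_pi.1 (hyd' t ht).snd k }
      Set.subset_union_left (fun t ht => by simp only [hyx t (hlt t ht), and_self])
    have hb' : b ∈ J ∪ Set.Ioo t₀ (b + ε) := Or.inr ⟨hlt t₀ ht₀, by linarith⟩
    rw [hJ'] at hb'
    exact hbJ hb'
  intro t ht
  obtain ⟨s, hsJ, hts⟩ := not_bddAbove_iff.1 hunb t
  exact hs.ordConnected.out ht₀ hsJ ⟨ht, hts.le⟩

end ThreeBody

/-! ### Unbounded inertia and the limiting shape. -/

open Filter Topology in
/-- A positive lower bound for `A x + B x ^ s` bounds `x > 0` away from zero. -/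
lemma exists_pos_le_of_le_add_rpow {A B c s : ℝ} (hs : 0 < s) (hc : 0 < c) :
    ∃ δ > 0, ∀ x > 0, c ≤ A * x + B * x ^ s → δ ≤ x := by
  have hcont : ContinuousAt (fun x : ℝ => A * x + B * x ^ s) 0 :=
    (continuousAt_const.mul continuousAt_id).add
      (continuousAt_const.mul (Real.continuousAt_rpow_const 0 s (Or.inr hs.le)))
  have h0 : A * 0 + B * (0 : ℝ) ^ s < c := by
    rw [Real.zero_rpow hs.ne']; simpa using hc
  have hev : ∀ᶠ x in 𝓝 (0 : ℝ), A * x + B * x ^ s < c := hcont.eventually_lt_const h0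
  obtain ⟨δ, hδ, h⟩ := Metric.eventually_nhds_iff.1 hev
  refine ⟨δ, hδ, fun x hx hcx => ?_⟩
  by_contra hlt
  exact absurd (h (by rw [Real.dist_eq, sub_zero, abs_of_pos hx]; exact not_le.1 hlt)) hcx.not_gt

namespace ThreeBody

variable {m : Fin 3 → ℝ} {a : ℝ} {J : Set ℝ} {q p : ℝ → Fin 3 → ℂ} {t : ℝ}

lemma smul_unitShape (hm : ∀ k, 0 < m k) {z : Fin 3 → ℂ} (hz : Function.Injective z) :
    √(inertia m z) • unitShape m z = z := by
  rw [unitShape, smul_smul, mul_inv_cancel₀ (Real.sqrt_pos.2 (inertia_pos hm hz)).ne', one_smul]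

lemma potential_eq_configMeasure_mul (hm : ∀ k, 0 < m k) (a : ℝ) {z : Fin 3 → ℂ}
    (hz : Function.Injective z) :
    potential m a z = configMeasure m a z * inertia m z ^ (-(a / 2)) := by
  have hI := inertia_pos hm hz
  rw [configMeasure, mul_assoc, ← Real.rpow_add hI, add_neg_cancel, Real.rpow_zero, mul_one]

lemma shapeSpeed_nonneg (hm : ∀ k, 0 < m k) {z : Fin 3 → ℂ} (hz : Function.Injective z)
    (w : Fin 3 → ℂ) : 0 ≤ shapeSpeed m z w := by
  refine nonneg_of_mul_nonneg_right ?_ (inertia_pos hm hz)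
  rw [← sum_mass_inner_shapeVelocity_self hm]
  exact Finset.sum_nonneg fun k _ => mul_nonneg (hm k).le (sq_nonneg _)

lemma IsSolution.isHomographic_of_shapeSpeed_eq_zero (h : IsSolution m a J q p)
    (hm : ∀ k, 0 < m k) (hκ : ∀ t ∈ J, shapeSpeed m (q t) (p t) = 0) : IsHomographic J q := by
  have hder : ∀ t ∈ J, HasDerivAt (fun s => unitShape m (q s)) 0 t := by
    intro t ht
    have hw : shapeVelocity m (q t) (p t) = 0 := by
      funext k
      have := norm_sq_shapeVelocity_le hm (q t) (p t) k
      rw [hκ t ht, mul_zero, mul_zero] at this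
      exact norm_eq_zero.1 (pow_eq_zero_iff two_ne_zero |>.1 (le_antisymm this (sq_nonneg _)))
    have := h.hasDerivAt_unitShape hm ht
    rwa [hw, smul_zero] at this
  obtain ⟨t₀, ht₀⟩ := h.nonempty
  refine ⟨t₀, ht₀, fun t ht => ?_⟩
  have hconst : unitShape m (q t) = unitShape m (q t₀) :=
    h.isOpen.is_const_of_deriv_eq_zero h.ordConnected.isPreconnected
      (fun x hx => (hder x hx).differentiableAt.differentiableWithinAt)
      (fun x hx => (hder x hx).deriv) ht ht₀
  have hr := Real.sqrt_pos.2 (inertia_pos hm (h.collisionFree t ht))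
  have hr₀ := Real.sqrt_pos.2 (inertia_pos hm (h.collisionFree t₀ ht₀))
  refine ⟨√(inertia m (q t)) * (√(inertia m (q t₀)))⁻¹, by positivity,
    LinearIsometryEquiv.refl ℝ ℂ, fun k => ?_⟩
  have h1 := congrFun (smul_unitShape hm (h.collisionFree t ht)) k
  rw [hconst, unitShape, smul_smul] at h1
  exact h1.symm

/-- If I were bounded, U would be bounded below, so by Lagrange–Jacobi the virial would grow at
least linearly; yet Cauchy–Schwarz bounds it by √(2T·I). -/
lemma IsSolution.not_bddAbove_inertia (h : IsSolution m a J q p) (hm : ∀ k, 0 < m k) (ha₀ : 0 < a)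
    (ha₂ : a < 2) {μ V t₀ : ℝ} (hJ : Set.Ici t₀ ⊆ J) (hμ : ∀ t ∈ J, configMeasure m a (q t) = μ)
    (hH : ∀ t ∈ J, 0 ≤ energy m a (q t) (p t)) (hV : ∀ t ∈ J, vis m (p t) ≤ V) (M : ℝ) :
    ∃ t ∈ J, M < inertia m (q t) := by
  by_contra! hM
  have ht₀ : t₀ ∈ J := hJ (Set.mem_Ici.2 le_rfl)
  have hM0 : 0 < M := (inertia_pos hm (h.collisionFree t₀ ht₀)).trans_le (hM t₀ ht₀)
  have hμ0 : 0 < μ := by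
    rw [← hμ t₀ ht₀, configMeasure]
    exact mul_pos (potential_pos hm ha₀ (h.collisionFree t₀ ht₀))
      (Real.rpow_pos_of_pos (inertia_pos hm (h.collisionFree t₀ ht₀)) _)
  -- Since 2T = 2H + 2U and H ≥ 0, the virial grows at rate at least (2 − a)U.
  set c := (2 - a) * (μ * M ^ (-(a / 2))) with hc
  have hc0 : 0 < c := mul_pos (by linarith) (mul_pos hμ0 (Real.rpow_pos_of_pos hM0 _))
  have hderiv : ∀ t ∈ J, c ≤ vis m (p t) - a * potential m a (q t) := by
    intro t ht
    have hI := inertia_pos hm (h.collisionFree t ht)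
    have hU : μ * M ^ (-(a / 2)) ≤ potential m a (q t) := by
      rw [potential_eq_configMeasure_mul hm a (h.collisionFree t ht), hμ t ht]
      exact mul_le_mul_of_nonneg_left
        (Real.rpow_le_rpow_of_nonpos hI (hM t ht) (by linarith)) hμ0.le
    have hE := hH t ht
    rw [energy_eq] at hE
    have := mul_le_mul_of_nonneg_left hU (show 0 ≤ 2 - a by linarith)
    linarith
  have hbound : ∀ t ∈ J, |virial (q t) (p t)| ≤ V * M + 1 := by
    intro t ht
    have h1 := shapeSpeed_nonneg hm (h.collisionFree t ht) (p t)
    have h2 : vis m (p t) * inertia m (q t) ≤ V * M := by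
      have hv : 0 ≤ vis m (p t) :=
        Finset.sum_nonneg fun k _ => div_nonneg (sq_nonneg _) (hm k).le
      exact mul_le_mul (hV t ht) (hM t ht) (inertia_nonneg hm _) (hv.trans (hV t ht))
    rw [shapeSpeed] at h1
    have h3 : |virial (q t) (p t)| ^ 2 ≤ V * M := by rw [sq_abs]; linarith
    nlinarith [abs_nonneg (virial (q t) (p t)), sq_nonneg (|virial (q t) (p t)| - 1)]
  have hVM : 0 ≤ V * M + 1 := (abs_nonneg _).trans (hbound t₀ ht₀)
  -- Long enough for the virial to gain more than twice its bound.
  set t₁ := t₀ + (2 * (V * M + 1) + 1) / c with ht₁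
  have hlt : t₀ < t₁ := by
    have : 0 < (2 * (V * M + 1) + 1) / c := by positivity
    linarith
  have hd : ∀ t ∈ Set.Icc t₀ t₁, HasDerivAt (fun s => virial (q s) (p s))
      (vis m (p t) - a * potential m a (q t)) t := fun t ht =>
    h.hasDerivAt_virial ha₀.ne' (hJ ht.1)
  obtain ⟨t, ht, hslope⟩ := exists_hasDerivAt_eq_slope (fun s => virial (q s) (p s))
    (fun t => vis m (p t) - a * potential m a (q t)) hlt
    (fun t ht => (hd t ht).continuousAt.continuousWithinAt)
    (fun t ht => hd t (Set.Ioo_subset_Icc_self ht))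
  have h1 := hderiv t (hJ ht.1.le)
  rw [hslope, le_div_iff₀ (by linarith)] at h1
  have h2 : c * (t₁ - t₀) = 2 * (V * M + 1) + 1 := by
    rw [ht₁]; field_simp; ring
  have h3 := abs_le.1 (hbound t₀ ht₀)
  have h4 := abs_le.1 (hbound t₁ (hJ hlt.le))
  linarith [h3.1, h4.2]

/-- A maximal solution with constant configurational measure and nonnegative energy whose shape
moves becomes unbounded, with bounded momenta. -/
lemma IsMaximalSolution.exists_lt_inertia (hsol : IsMaximalSolution m a J q p) (hm : ∀ k, 0 < m k)
    (ha₀ : 0 < a) (ha₂ : a < 2) {μ t₀ : ℝ} (ht₀ : t₀ ∈ J)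
    (hμ : ∀ t ∈ J, configMeasure m a (q t) = μ) (hH : 0 ≤ energy m a (q t₀) (p t₀))
    (hκ : 0 < shapeSpeed m (q t₀) (p t₀)) (M : ℝ) : ∃ t ∈ J, M < inertia m (q t) := by
  have h := hsol.1
  have hen : ∀ t ∈ J, energy m a (q t) (p t) = energy m a (q t₀) (p t₀) := fun t ht =>
    h.energy_eq_energy ha₀.ne' ht ht₀
  set E := energy m a (q t₀) (p t₀) with hE
  have hU : ∀ t ∈ J, potential m a (q t) = μ * inertia m (q t) ^ (-(a / 2)) := fun t ht => by
    rw [potential_eq_configMeasure_mul hm a (h.collisionFree t ht), hμ t ht]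
  have hvis : ∀ t ∈ J, vis m (p t) = 2 * E + 2 * potential m a (q t) := fun t ht => by
    have := hen t ht
    rw [energy_eq] at this
    linarith
  -- Applied to κ ≤ 2E·I + 2μ·I^(1 − a/2); the exponent is positive because a < 2.
  obtain ⟨ι, hι, hIι⟩ := exists_pos_le_of_le_add_rpow (A := 2 * E) (B := 2 * μ)
    (show 0 < 1 - a / 2 by linarith) hκ
  have hI : ∀ t ∈ J, ι ≤ inertia m (q t) := by
    intro t ht
    have hI := inertia_pos hm (h.collisionFree t ht)
    refine hIι _ hI ?_
    have hp : inertia m (q t) ^ (1 - a / 2) = inertia m (q t) ^ (-(a / 2)) * inertia m (q t) := by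
      rw [← Real.rpow_add_one hI.ne']; ring_nf
    rw [h.shapeSpeed_eq hm ha₀.ne' hμ ht₀ ht, shapeSpeed, hvis t ht, hU t ht, hp]
    nlinarith [sq_nonneg (virial (q t) (p t))]
  have hμ0 : 0 ≤ μ := by
    rw [← hμ t₀ ht₀, configMeasure]
    exact (mul_pos (potential_pos hm ha₀ (h.collisionFree t₀ ht₀))
      (Real.rpow_pos_of_pos (inertia_pos hm (h.collisionFree t₀ ht₀)) _)).le
  have hUle : ∀ t ∈ J, potential m a (q t) ≤ μ * ι ^ (-(a / 2)) := fun t ht => by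
    rw [hU t ht]
    exact mul_le_mul_of_nonneg_left (Real.rpow_le_rpow_of_nonpos hι (hI t ht) (by linarith)) hμ0
  obtain ⟨V, hV⟩ : ∃ V, ∀ t ∈ J, vis m (p t) ≤ V :=
    ⟨2 * E + 2 * (μ * ι ^ (-(a / 2))), fun t ht => by linarith [hvis t ht, hUle t ht]⟩
  obtain ⟨δ, hδ, hδU⟩ := potential_le_imp_le_norm_sub hm ha₀ (μ * ι ^ (-(a / 2)))
  obtain ⟨l, hl⟩ := Finite.exists_max m
  have hJ : Set.Ici t₀ ⊆ J := by
    refine hsol.Ici_subset ha₀ (P := √(V * m l)) ht₀ hδ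
      (fun t ht => hδU _ (h.collisionFree t ht) (hUle t ht)) fun t ht => ?_
    rw [pi_norm_le_iff_of_nonneg (Real.sqrt_nonneg _)]
    intro k
    apply Real.le_sqrt_of_sq_le
    have h1 : ‖p t k‖ ^ 2 / m k ≤ V := le_trans
      (Finset.single_le_sum (f := fun k => ‖p t k‖ ^ 2 / m k)
        (fun j _ => div_nonneg (sq_nonneg _) (hm j).le) (Finset.mem_univ k)) (hV t ht)
    have hV0 : 0 ≤ V := (div_nonneg (sq_nonneg _) (hm k).le).trans h1
    rw [div_le_iff₀ (hm k)] at h1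
    exact h1.trans (mul_le_mul_of_nonneg_left (hl k) hV0)
  exact h.not_bddAbove_inertia hm ha₀ ha₂ hJ hμ (fun t ht => by rw [hen t ht]; exact hH) hV M

open Filter Topology in
/-- Along an unbounded solution of constant configurational measure, the shapes accumulate at a
central configuration. -/
lemma IsSolution.exists_isCentralConfig (h : IsSolution m a J q p) (hm : ∀ k, 0 < m k)
    (ha₀ : 0 < a) (ha₂ : a < 2) (hcm : ∀ t ∈ J, ∑ k, m k • q t k = 0) {μ : ℝ}
    (hμ : ∀ t ∈ J, configMeasure m a (q t) = μ) (hunb : ∀ M, ∃ t ∈ J, M < inertia m (q t)) :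
    ∃ Q, IsCentralConfig m a Q ∧ configMeasure m a Q = μ ∧
      Q ∈ closure ((fun t => unitShape m (q t)) '' J) := by
  obtain ⟨δ, hδ0, hδ⟩ := potential_le_imp_le_norm_sub hm ha₀ μ
  obtain ⟨C, hC⟩ := h.exists_norm_sq_defect_le hm ha₀.ne' hμ hδ0 hδ
  choose t htJ htI using fun n : ℕ => hunb n
  have hS : ∀ n, unitShape m (q (t n)) ∈ separatedShapes m δ := fun n =>
    h.unitShape_mem_separatedShapes hm hμ hδ (htJ n)
  obtain ⟨Q, hQS, φ, hφ, hlim⟩ := (isCompact_separatedShapes hm δ).tendsto_subseq hS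
  have hinj := injective_of_mem_separatedShapes hδ0 hQS
  have hinertia : Tendsto (fun n => √(inertia m (q (t (φ n))))) atTop atTop :=
    Real.tendsto_sqrt_atTop.comp (tendsto_atTop_mono (fun n => (htI (φ n)).le)
      (tendsto_natCast_atTop_atTop.comp hφ.tendsto_atTop))
  have hcmQ : ∑ k, m k • Q k = 0 := by
    have hc : Continuous fun z : Fin 3 → ℂ => ∑ k, m k • z k := by fun_prop
    refine tendsto_nhds_unique ((hc.tendsto Q).comp hlim) ?_
    refine tendsto_const_nhds.congr fun n => ?_
    exact (unitShape_mem_configSpace hm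
      ⟨h.collisionFree _ (htJ (φ n)), hcm _ (htJ (φ n))⟩).2.symm
  have hμQ : configMeasure m a Q = μ := by
    rw [configMeasure_of_inertia_eq_one hQS.1]
    refine tendsto_nhds_unique ((continuousAt_potential m a hinj).tendsto.comp hlim) ?_
    refine tendsto_const_nhds.congr fun n => ?_
    have hz := h.collisionFree _ (htJ (φ n))
    exact ((configMeasure_of_inertia_eq_one (inertia_unitShape hm hz)).symm.trans
      ((configMeasure_unitShape hm a hz).trans (hμ _ (htJ (φ n))))).symm
  have hdef : ∀ k, defect m a μ Q k = 0 := by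
    intro k
    have hcont : ContinuousAt (fun z => defect m a μ z k) Q :=
      (contDiffAt_force m a hinj 1 k).continuousAt.add
        (show Continuous fun z : Fin 3 → ℂ => (a * μ * m k) • z k by fun_prop).continuousAt
    have h1 : Tendsto (fun n => ‖defect m a μ (unitShape m (q (t (φ n)))) k‖ ^ 2) atTop
        (𝓝 (‖defect m a μ Q k‖ ^ 2)) := ((hcont.tendsto.comp hlim).norm.pow 2)
    -- Here a < 2 makes the bound on the defect tend to zero.
    have h2 : Tendsto (fun n => C * √(inertia m (q (t (φ n)))) ^ (a - 2)) atTop (𝓝 (C * 0)) := by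
      have := (tendsto_rpow_neg_atTop (show 0 < 2 - a by linarith)).comp hinertia
      rw [neg_sub] at this
      exact this.const_mul C
    have h3 := le_of_tendsto_of_tendsto' h1 h2 fun n => hC _ (htJ (φ n)) k
    rw [mul_zero] at h3
    exact norm_eq_zero.1 (pow_eq_zero_iff two_ne_zero |>.1 (le_antisymm h3 (sq_nonneg _)))
  refine ⟨Q, ⟨⟨hinj, hcmQ⟩, hQS.1, fun k => ?_⟩, hμQ,
    mem_closure_of_tendsto hlim (Eventually.of_forall fun n => ⟨_, htJ (φ n), rfl⟩)⟩
  rw [hμQ]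
  exact hdef k

/-- Only unit shapes approach Q, so the orbit is enlarged to its cone of positive multiples. The
cone is connected, lies in the level set by scale invariance, and stays connected when a point of
its closure is added. -/
lemma IsSolution.mem_connectedComponentIn (h : IsSolution m a J q p) (hm : ∀ k, 0 < m k)
    (hcm : ∀ t ∈ J, ∑ k, m k • q t k = 0) {Q : Fin 3 → ℂ} (hQ : Q ∈ configSpace m)
    (hμ : ∀ t ∈ J, configMeasure m a (q t) = configMeasure m a Q)
    (hcl : Q ∈ closure ((fun t => unitShape m (q t)) '' J)) (ht : t ∈ J) :
    q t ∈ connectedComponentIn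
      {z | z ∈ configSpace m ∧ configMeasure m a z = configMeasure m a Q} Q := by
  set A := (fun x : ℝ × ℝ => x.1 • q x.2) '' (Set.Ioi 0 ×ˢ J) with hA
  have hAconn : IsPreconnected A := by
    refine (isPreconnected_Ioi.prod h.ordConnected.isPreconnected).image _ ?_
    have hqc : ContinuousOn q J := fun s hs =>
      (hasDerivAt_pi.2 (h.hasDerivAt_pos s hs)).continuousAt.continuousWithinAt
    exact continuousOn_fst.smul (hqc.comp continuousOn_snd fun x hx => hx.2)
  have hclA : Q ∈ closure A := by
    refine closure_mono ?_ hcl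
    rintro _ ⟨s, hs, rfl⟩
    exact ⟨((√(inertia m (q s)))⁻¹, s), ⟨inv_pos.2 (Real.sqrt_pos.2
      (inertia_pos hm (h.collisionFree s hs))), hs⟩, rfl⟩
  have hconn : IsPreconnected (insert Q A) :=
    hAconn.subset_closure (Set.subset_insert Q A) (Set.insert_subset hclA subset_closure)
  refine hconn.subset_connectedComponentIn (Set.mem_insert Q A) ?_
    (Set.mem_insert_of_mem Q ⟨(1, t), ⟨Set.mem_Ioi.2 one_pos, ht⟩, one_smul ℝ (q t)⟩)
  refine Set.insert_subset ⟨hQ, rfl⟩ ?_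
  rintro _ ⟨⟨s, τ⟩, ⟨hs, hτ⟩, rfl⟩
  exact ⟨smul_mem_configSpace ⟨h.collisionFree τ hτ, hcm τ hτ⟩ hs,
    (configMeasure_smul hm a (q τ) hs).trans (hμ τ hτ)⟩

end ThreeBody

theorem theorem5 (m : Fin 3 → ℝ) (hm : ∀ k, 0 < m k) (a : ℝ) (ha₀ : 0 < a) (ha₂ : a < 2)
    (J : Set ℝ) (q p : ℝ → Fin 3 → ℂ)
    (hsol : ThreeBody.IsMaximalSolution m a J q p)
    (hcm : ∀ t ∈ J, ∑ k, m k • q t k = 0)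
    (t₀ : ℝ) (ht₀ : t₀ ∈ J)
    (hH : 0 ≤ ThreeBody.energy m a (q t₀) (p t₀))
    (hμ : ∀ t ∈ J, ThreeBody.configMeasure m a (q t) = ThreeBody.configMeasure m a (q t₀))
    (hcrit : ∀ k, q t₀ ∉ ThreeBody.criticalPath m a k) :
    ThreeBody.IsHomographic J q := by
  have h := hsol.1
  rcases (ThreeBody.shapeSpeed_nonneg hm (h.collisionFree t₀ ht₀) (p t₀)).eq_or_lt with hκ | hκ
  · exact h.isHomographic_of_shapeSpeed_eq_zero hm fun t ht =>
      (h.shapeSpeed_eq hm ha₀.ne' hμ ht ht₀).trans hκ.symm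
  have hunb := hsol.exists_lt_inertia hm ha₀ ha₂ ht₀ hμ hH hκ
  obtain ⟨Q, hQ, hQμ, hcl⟩ := h.exists_isCentralConfig hm ha₀ ha₂ hcm hμ hunb
  have hμ' : ∀ t ∈ J, ThreeBody.configMeasure m a (q t) = ThreeBody.configMeasure m a Q :=
    fun t ht => (hμ t ht).trans hQμ.symm
  rcases hQ.isEquilateral_or hm ha₀ with hQe | ⟨k, hk⟩
  · have he : ∀ t ∈ J, ThreeBody.IsEquilateral (q t) := fun t ht =>
      ThreeBody.IsEquilateral.of_configMeasure_eq hm ha₀ hQ.1 hQe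
        ⟨h.collisionFree t ht, hcm t ht⟩ (hμ' t ht)
    exact ⟨t₀, ht₀, fun t ht => ThreeBody.IsEquilateral.similar hm
      ⟨h.collisionFree t ht, hcm t ht⟩ (he t ht) ⟨h.collisionFree t₀ ht₀, hcm t₀ ht₀⟩ (he t₀ ht₀)⟩
  · exact absurd ⟨Q, hk, h.mem_connectedComponentIn hm hcm hQ.1 hμ' hcl ht₀⟩ (hcrit k)
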